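/- Let $\Omega\subset\mathbb R^N$ be open, and let $d$ denote the distance to $\partial\Omega$ (with $d\equiv+\infty$ in condition (H1) if $\partial\Omega=\emptyset$). Let $a$ be a continuous function on $\overline\Omega$ with values in the real $N\times N$ matrices and $a(x)p\cdot p\ge 0$ for all $x\in\overline\Omega$, $p\in\mathbb R^N$; let $H$ be continuous on $\overline\Omega\times\mathbb R^N$ with $H(x,p)\ge K_1|p|^m-K_2$ for all $x\in\overline\Omega$, $p\in\mathbb R^N$, for some constants $K_1>0$, $K_2\in\mathbb R$, $m>2$; and let $c,f:\overline\Omega\to\mathbb R$ be continuous. Put $\alpha=\frac{m-2}{m-1}$ and consider $$-\mathrm{Tr}(a(x)D^2u)+H(x,Du)+c(x)u=f(x)\quad\text{in }\Omega.\qquad(1)$$ "Subsolution" means upper semicontinuous viscosity subsolution; "locally bounded" means bounded on compact subsets of $\Omega$. We call $\Omega$ a $C^{1,1}$-domain if there is $\delta_0>0$ such that $d$ is differentiable with Lipschitz continuous gradient on $\{x\in\Omega: d(x)<\delta_0\}$. We write $u\in C^{0,\alpha}(\overline\Omega)$ if $u$ extends to a bounded, globally $\alpha$-Hölder continuous function on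 $\overline\Omega$. A function $G(M,p)$ of a symmetric matrix $M$ and $p\in\mathbb R^N$ is elliptic if $G(X,p)\le G(Y,p)$ whenever $X\ge Y$. 1. Suppose $\Omega$ is bounded and $u$ is a locally bounded subsolution of (1). Then there are $r_0>0$ and, for every $0<r\le r_0$, a continuous elliptic function $G_r$ and a radial function $w_r$ such that, for every $0<r\le r_0$: - (H1) $u$ is a subsolution of $G_r(D^2u,Du)\le0$ in $B_r(x)$ for every $x\in\Omega$ with $d(x)\ge 2r$; - (H2) $w_r\in C(\overline{B_r(0)})$, $w_r(0)=0$, $w_r\ge0$ in $B_r(0)$, and for some $\eta_r>0$, $w_r$ is a viscosity supersolution of $G_r(D^2w_r,Dw_r)\ge\eta_r$ on $\overline{B_r(0)}\setminus\{0\}$, up to the boundary (state-constraint sense: minima of $w_r-\varphi$ are taken relative to $\overline{B_r(0)}\setminus\{0\}$); - (H3) every bounded upper semicontinuous function $v$ on $B_r(0)$ which is a viscosity subsolution of $G_r(D^2v,Dv)\le0$ in $B_r(0)\setminus\{0\}$ satisfies $v(y)\le v(0)+w_r(y)$ in $B_r(0)$; - $w_r(x)\le \tilde K_r|x|^\alpha$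 on $\overline{B_r(0)}$ for some constant $\tilde K_r>0$. 2. Every locally bounded subsolution $u$ of (1) is in $C^{0,\alpha}_{\rm loc}(\Omega)$. 3. If $\Omega$ is a $C^{1,1}$-domain, $a,c,f$ are bounded on $\Omega$ (which is automatic if $\Omega$ is bounded), and the subsolution $u$ is bounded on $\Omega$, then $u\in C^{0,\alpha}(\overline\Omega)$. 4. If $\Omega$ is a bounded $C^{1,1}$-domain, then every locally bounded subsolution $u$ of (1) for which $x\mapsto c(x)u(x)$ is bounded from below on $\Omega$ is bounded on $\Omega$, and therefore $u\in C^{0,\alpha}(\overline\Omega)$. -/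

import Mathlib

open Set Metric

open scoped NNReal

noncomputable section

namespace SuperquadHJ

/-- The Euclidean space `ℝ^N`. -/
abbrev Eucl (N : ℕ) : Type := EuclideanSpace ℝ (Fin N)

/-- The Hessian matrix `D²φ(x)`. -/
def hessian {N : ℕ} (φ : Eucl N → ℝ) (x : Eucl N) : Matrix (Fin N) (Fin N) ℝ :=
  Matrix.of fun i j =>
    fderiv ℝ (fderiv ℝ φ) x (EuclideanSpace.single i 1) (EuclideanSpace.single j 1)

/-- A second-order operator `F(D²u, Du, u, x)`; only its values at symmetric matrices matter. -/
abbrev Operator (N : ℕ) : Type := Matrix (Fin N) (Fin N) ℝ → Eucl N → ℝ → Eucl N → ℝ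

/-- `u` is an upper semicontinuous viscosity subsolution of `F(D²u, Du, u, x) ≤ 0` on `A`. -/
def IsViscositySubsolution {N : ℕ} (F : Operator N) (A : Set (Eucl N)) (u : Eucl N → ℝ) : Prop :=
  UpperSemicontinuousOn u A ∧
    ∀ φ : Eucl N → ℝ, ContDiff ℝ 2 φ → ∀ x ∈ A, IsLocalMaxOn (fun y => u y - φ y) A x →
      F (hessian φ x) (gradient φ x) (u x) x ≤ 0

/-- `w` is a lower semicontinuous viscosity supersolution of `F(D²w, Dw, w, x) ≥ 0` on `A`.
Minima are relative to `A`, so that boundary points of `A` lying in `A` carry the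
state-constraint condition (supersolution up to the boundary). -/
def IsViscositySupersolution {N : ℕ} (F : Operator N) (A : Set (Eucl N)) (w : Eucl N → ℝ) : Prop :=
  LowerSemicontinuousOn w A ∧
    ∀ φ : Eucl N → ℝ, ContDiff ℝ 2 φ → ∀ x ∈ A, IsLocalMinOn (fun y => w y - φ y) A x →
      0 ≤ F (hessian φ x) (gradient φ x) (w x) x

/-- The operator `-Tr(a(x)D²u) + H(x,Du) + c(x)u - f(x)`. -/
def hjOperator {N : ℕ} (a : Eucl N → Matrix (Fin N) (Fin N) ℝ) (H : Eucl N → Eucl N → ℝ)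
    (c f : Eucl N → ℝ) : Operator N :=
  fun M p s x => -(a x * M).trace + H x p + c x * s - f x

/-- Bounded on a set. -/
def BoundedOn {N : ℕ} (u : Eucl N → ℝ) (A : Set (Eucl N)) : Prop :=
  ∃ C : ℝ, ∀ x ∈ A, |u x| ≤ C

/-- Locally bounded on `A`: bounded on every compact subset of `A`. -/
def LocallyBoundedOn {N : ℕ} (u : Eucl N → ℝ) (A : Set (Eucl N)) : Prop :=
  ∀ K ⊆ A, IsCompact K → BoundedOn u K

/-- `u ∈ C^{0,α}_loc(Ω)`. -/
def LocallyHolderOn {N : ℕ} (α : ℝ) (u : Eucl N → ℝ) (Ω : Set (Eucl N)) : Prop :=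
  ∀ K ⊆ Ω, IsCompact K → ∃ C : ℝ≥0, HolderOnWith C α.toNNReal u K

/-- `u ∈ C^{0,α}(closure Ω)`: the function `u` on `Ω` extends to a `C^{0,α}` function
on the closure of `Ω`. -/
def HolderUpToBoundary {N : ℕ} (α : ℝ) (u : Eucl N → ℝ) (Ω : Set (Eucl N)) : Prop :=
  ∃ v : Eucl N → ℝ, EqOn v u Ω ∧ BoundedOn v (closure Ω) ∧
    ∃ C : ℝ≥0, HolderOnWith C α.toNNReal v (closure Ω)

/-- `C^{1,1}` open sets: the distance `d` to `∂Ω` is differentiable with Lipschitz gradient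
in `{x ∈ Ω : d(x) < δ₀}` for some `δ₀ > 0`. -/
def IsC11Domain {N : ℕ} (Ω : Set (Eucl N)) : Prop :=
  IsOpen Ω ∧ ∃ δ₀ : ℝ, 0 < δ₀ ∧
    (∀ x ∈ Ω, infDist x (frontier Ω) < δ₀ →
      DifferentiableAt ℝ (fun y => infDist y (frontier Ω)) x) ∧
    ∃ L : ℝ≥0, LipschitzOnWith L (gradient fun y => infDist y (frontier Ω))
      {x | x ∈ Ω ∧ infDist x (frontier Ω) < δ₀}

/-- `G : S^N × ℝ^N → ℝ` is continuous and satisfies the (degenerate) ellipticity condition. -/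
def IsContinuousElliptic {N : ℕ} (G : Matrix (Fin N) (Fin N) ℝ → Eucl N → ℝ) : Prop :=
  ContinuousOn (fun q : Matrix (Fin N) (Fin N) ℝ × Eucl N => G q.1 q.2)
      ({M | M.IsSymm} ×ˢ univ) ∧
    ∀ (p : Eucl N) (X Y : Matrix (Fin N) (Fin N) ℝ), X.IsSymm → Y.IsSymm →
      (X - Y).PosSemidef → G X p ≤ G Y p

/-- Assumption (H1-b): for `0 < r ≤ r₀`, the function `G r` is continuous and elliptic, and `u` is
a subsolution of `G r (D²u, Du) ≤ 0` in `B_r(x)` for every `x ∈ Ω` with `d(x) ≥ b r`. (The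
extended distance is `∞` when `∂Ω` is empty.) -/
def AssumptionH1 {N : ℕ} (b : ℝ) (Ω : Set (Eucl N)) (u : Eucl N → ℝ) (r₀ : ℝ)
    (G : ℝ → Matrix (Fin N) (Fin N) ℝ → Eucl N → ℝ) : Prop :=
  ∀ r : ℝ, 0 < r → r ≤ r₀ → IsContinuousElliptic (G r) ∧
    ∀ x ∈ Ω, ENNReal.ofReal (b * r) ≤ infEDist x (frontier Ω) →
      IsViscositySubsolution (fun M p _ _ => G r M p) (ball x r) u

/-- Assumption (H2): for `0 < r ≤ r₀`, `w r` is continuous on the closed ball, `w r 0 = 0`,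
`w r ≥ 0`, and `w r` is a viscosity supersolution of `G r (D²w, Dw) ≥ η`, with `η > 0`, on the
closed ball of radius `r` minus its center (thus up to the boundary sphere). -/
def AssumptionH2 {N : ℕ} (r₀ : ℝ) (G : ℝ → Matrix (Fin N) (Fin N) ℝ → Eucl N → ℝ)
    (w : ℝ → Eucl N → ℝ) : Prop :=
  ∀ r : ℝ, 0 < r → r ≤ r₀ →
    ContinuousOn (w r) (closedBall 0 r) ∧ w r 0 = 0 ∧ (∀ y ∈ ball (0 : Eucl N) r, 0 ≤ w r y) ∧
    ∃ η : ℝ, 0 < η ∧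
      IsViscositySupersolution (fun M p _ _ => G r M p - η) (closedBall 0 r \ {0}) (w r)

/-- Assumption (H3): for `0 < r ≤ r₀`, every bounded usc viscosity subsolution `v` of
`G r (D²v, Dv) ≤ 0` in `B_r(0) \ {0}` satisfies `v y ≤ v 0 + w r y` in `B_r(0)`. -/
def AssumptionH3 {N : ℕ} (r₀ : ℝ) (G : ℝ → Matrix (Fin N) (Fin N) ℝ → Eucl N → ℝ)
    (w : ℝ → Eucl N → ℝ) : Prop :=
  ∀ r : ℝ, 0 < r → r ≤ r₀ → ∀ v : Eucl N → ℝ,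
    BoundedOn v (ball 0 r) → UpperSemicontinuousOn v (ball 0 r) →
    IsViscositySubsolution (fun M p _ _ => G r M p) (ball 0 r \ {0}) v →
    ∀ y ∈ ball (0 : Eucl N) r, v y ≤ v 0 + w r y

end SuperquadHJ

end

open SuperquadHJ

open Set Metric Filter Topology
open scoped NNReal
open SuperquadHJ

/-! Where the coefficients are bounded and `c u` is bounded below, a subsolution of (1) satisfies an
`x`-independent inequality: `extremalOperator` takes the supremum of the trace term over all
admissible matrices and keeps only `K₁|p|^m` minus a constant. Everything afterwards concerns this
inequality, and the comparison argument tests it only with isotropic paraboloids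
(`IsParaboloidSubsolution`).

The barrier is `w(x) = (B/α)(|x|^α + r^α - (r-|x|)^α)`. The exponent satisfies `(α-1)m = α-2`, so
`|Dw|^m` and the curvature of `w` blow up at the same rate; since `m > 2`, a large `B` makes the
gradient term win (`exists_barrier_constant`). The slope is also infinite at `|x| = r`, so no smooth
function touches `w` from below there and the state-constraint condition is vacuous. Hence a
subsolution lies below its central value plus `w` with no control on the sphere `|x| = r`
(`IsParaboloidSubsolution.le_add_barrier_zero`). The proof doubles variables, but needs no matrix
lemma: `w` is touched from above by paraboloids, which are transferred to the subsolution by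
translation and dilation.

Exchanging the two centres gives a Hölder estimate whose constant does not depend on the radius or
on bounds for `u` (`IsParaboloidSubsolution.exists_two_point_estimate`). It is valid for points
closer to each other than to the boundary. In a `C^{1,1}` domain, other nearby points are first
pushed inward along the gradient of the distance; the oscillation along each such normal segment is
a geometric series of interior estimates (`exists_local_holder_of_isC11Domain`). On a bounded domain
the uniform local estimate itself yields boundedness. -/

/-! ### The barrier profile and scalar power inequalities -/

/-- The radial profile of the barrier on the ball of radius `r`. -/
noncomputable def barrierProfile (α B r s : ℝ) : ℝ := B / α * (s ^ α + r ^ α - (r - s) ^ α)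

lemma barrierProfile_zero {α : ℝ} (hα : 0 < α) (B r : ℝ) : barrierProfile α B r 0 = 0 := by
  simp [barrierProfile, Real.zero_rpow hα.ne']

lemma continuous_barrierProfile {α : ℝ} (hα : 0 < α) (B r : ℝ) :
    Continuous (barrierProfile α B r) := by
  have h : Continuous fun s : ℝ => s ^ α := Real.continuous_rpow_const hα.le
  have h2 : Continuous fun s : ℝ => (r - s) ^ α := h.comp (continuous_const.sub continuous_id)
  exact continuous_const.mul ((h.add continuous_const).sub h2)

lemma barrierProfile_nonneg {α B r s : ℝ} (hα : 0 < α) (hB : 0 ≤ B) (hs : 0 ≤ s) (hsr : s ≤ r) :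
    0 ≤ barrierProfile α B r s := by
  have h1 : (r - s) ^ α ≤ r ^ α := Real.rpow_le_rpow (by linarith) (by linarith) hα.le
  have h2 : 0 ≤ s ^ α := Real.rpow_nonneg hs _
  exact mul_nonneg (div_nonneg hB hα.le) (by linarith)

/-- Subadditivity of `s ↦ s^α` absorbs the singular term at the outer radius into the one at the
centre. -/
lemma barrierProfile_le {α B r s : ℝ} (hα : 0 < α) (hα1 : α ≤ 1) (hB : 0 ≤ B) (hs : 0 ≤ s)
    (hsr : s ≤ r) : barrierProfile α B r s ≤ 2 * B / α * s ^ α := by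
  have h1 : r ^ α ≤ s ^ α + (r - s) ^ α := by
    have := Real.rpow_add_le_add_rpow hs (sub_nonneg.2 hsr) hα.le hα1
    simpa using this
  have h2 : B / α * (s ^ α + r ^ α - (r - s) ^ α) ≤ B / α * (2 * s ^ α) :=
    mul_le_mul_of_nonneg_left (by linarith) (div_nonneg hB hα.le)
  calc barrierProfile α B r s ≤ B / α * (2 * s ^ α) := h2
    _ = _ := by ring

/-- Bernoulli for the exponent `1-α` bounds `(1-z)^(1-α)` by `1-(1-α)z`. Dividing `1-z` by this and
using `1/(1-y) ≥ 1+y` gives `(1-z)(1+(1-α)z)`, which is the left side expanded. -/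
lemma rpow_one_sub_ge {α z : ℝ} (hα : 0 < α) (hα1 : α ≤ 1) (hz : z < 1) :
    1 - α * z - (1 - α) * z ^ 2 ≤ (1 - z) ^ α := by
  have hz' : 0 < 1 - z := by linarith
  have h1 : (1 - z) ^ (1 - α) ≤ 1 - (1 - α) * z := by
    have := rpow_one_add_le_one_add_mul_self (s := -z) (by linarith) (p := 1 - α)
      (by linarith) (by linarith)
    rw [← sub_eq_add_neg] at this; linarith
  have hpos : 0 < (1 - z) ^ (1 - α) := Real.rpow_pos_of_pos hz' _
  have h2 : (1 - z) ^ α * (1 - z) ^ (1 - α) = 1 - z := by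
    rw [← Real.rpow_add hz']; simp
  by_cases hneg : 1 + (1 - α) * z ≤ 0
  · have : 1 - α * z - (1 - α) * z ^ 2 = (1 - z) * (1 + (1 - α) * z) := by ring
    rw [this]
    exact (mul_nonpos_of_nonneg_of_nonpos hz'.le hneg).trans (Real.rpow_nonneg hz'.le _)
  · push Not at hneg
    have h3 : (1 + (1 - α) * z) * (1 - z) ^ (1 - α) ≤ 1 := by
      have := mul_le_mul_of_nonneg_left h1 hneg.le
      nlinarith [sq_nonneg ((1 - α) * z)]
    have h4 : (1 - α * z - (1 - α) * z ^ 2) * (1 - z) ^ (1 - α)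
        ≤ (1 - z) ^ α * (1 - z) ^ (1 - α) := by
      rw [h2]
      have := mul_le_mul_of_nonneg_left h3 hz'.le
      nlinarith
    exact le_of_mul_le_mul_right h4 hpos

lemma rpow_sub_ge {α t R : ℝ} (hα : 0 < α) (hα1 : α ≤ 1) (ht : 0 < t) (hR : R < t) :
    t ^ α - α * t ^ (α - 1) * R - (1 - α) * t ^ (α - 2) * R ^ 2 ≤ (t - R) ^ α := by
  have h := rpow_one_sub_ge hα hα1 ((div_lt_one ht).2 hR)
  have h0 : (t - R) ^ α = t ^ α * (1 - R / t) ^ α := by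
    rw [← Real.mul_rpow ht.le]
    · congr 1; field_simp
    · rw [sub_nonneg, div_le_one ht]; exact hR.le
  rw [h0]
  have h1 : t ^ (α - 1) = t ^ α / t := by rw [Real.rpow_sub ht, Real.rpow_one]
  have h2 : t ^ (α - 2) = t ^ α / t ^ 2 := by
    rw [Real.rpow_sub ht, Real.rpow_two]
  rw [h1, h2]
  calc _ = t ^ α * (1 - α * (R / t) - (1 - α) * (R / t) ^ 2) := by field_simp
    _ ≤ _ := mul_le_mul_of_nonneg_left h (Real.rpow_nonneg ht.le _)

/-- An upper bound for the curvature of the barrier. -/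
noncomputable def barrierCurv {E : Type*} [NormedAddCommGroup E] (α B r : ℝ) (x : E) : ℝ :=
  B * (2 + 4 / α) * (‖x‖ ^ (α - 2) + (r - ‖x‖) ^ (α - 2))

lemma barrierCurv_nonneg {E : Type*} [NormedAddCommGroup E] {α B r : ℝ} (hα : 0 < α) (hB : 0 ≤ B) {x : E} (hxr : ‖x‖ ≤ r) :
    0 ≤ barrierCurv α B r x := by
  have := Real.rpow_nonneg (norm_nonneg x) (α - 2)
  have := Real.rpow_nonneg (sub_nonneg.2 hxr) (α - 2)
  unfold barrierCurv; positivity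

/-! ### Paraboloids above the barrier, and its behaviour at the outer sphere -/

section
variable {E : Type*} [NormedAddCommGroup E] [InnerProductSpace ℝ E]

/-- Since `‖y‖²` is exactly quadratic about `x`, Bernoulli for the concave power `α/2` of it
suffices, and the bound is global. -/
lemma norm_rpow_le_paraboloid {α : ℝ} (hα : 0 < α) (hα1 : α ≤ 1) {x : E} (hx : x ≠ 0) (y : E) :
    ‖y‖ ^ α ≤ ‖x‖ ^ α + α * ‖x‖ ^ (α - 2) * (inner ℝ x (y - x) + ‖y - x‖ ^ 2 / 2) := by
  have hs : 0 < ‖x‖ := norm_pos_iff.2 hx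
  have hy : ‖y‖ ^ 2 = ‖x‖ ^ 2 + 2 * inner ℝ x (y - x) + ‖y - x‖ ^ 2 := by
    rw [← norm_add_sq_real, add_sub_cancel]
  set i := inner ℝ x (y - x)
  set q := ‖y - x‖ ^ 2
  have hb := rpow_one_add_le_one_add_mul_self (s := (2 * i + q) / ‖x‖ ^ 2) (p := α / 2)
    (by rw [le_div_iff₀ (by positivity)]; nlinarith [sq_nonneg ‖y‖]) (by linarith) (by linarith)
  have hsq : ∀ b : ℝ, 0 ≤ b → (b ^ 2) ^ (α / 2) = b ^ α := by
    intro b hb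
    rw [← Real.rpow_two, ← Real.rpow_mul hb]; congr 1; ring
  have h1 : ‖y‖ ^ α = ‖x‖ ^ α * (1 + (2 * i + q) / ‖x‖ ^ 2) ^ (α / 2) := by
    rw [← hsq _ (norm_nonneg y), ← hsq _ hs.le, ← Real.mul_rpow (by positivity)]
    · congr 1; rw [hy]; field_simp; ring
    · have : 1 + (2 * i + q) / ‖x‖ ^ 2 = ‖y‖ ^ 2 / ‖x‖ ^ 2 := by rw [hy]; field_simp; ring
      rw [this]; positivity
  have h2 : ‖x‖ ^ (α - 2) = ‖x‖ ^ α / ‖x‖ ^ 2 := by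
    rw [Real.rpow_sub hs, Real.rpow_two]
  rw [h1, h2]
  calc _ ≤ ‖x‖ ^ α * (1 + α / 2 * ((2 * i + q) / ‖x‖ ^ 2)) :=
        mul_le_mul_of_nonneg_left hb (Real.rpow_nonneg hs.le _)
    _ = _ := by field_simp

lemma rpow_sub_norm_ge_paraboloid {α r : ℝ} (hα : 0 < α) (hα1 : α ≤ 1) {x y : E} (hx : x ≠ 0)
    (hxr : ‖x‖ < r) (h1 : ‖y - x‖ ≤ ‖x‖ / 2) (h2 : ‖y - x‖ ≤ (r - ‖x‖) / 2) :
    (r - ‖x‖) ^ α - α * (r - ‖x‖) ^ (α - 1) / ‖x‖ * (inner ℝ x (y - x) + ‖y - x‖ ^ 2 / 2)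
      - 2 * (1 - α) * (r - ‖x‖) ^ (α - 2) * ‖y - x‖ ^ 2 ≤ (r - ‖y‖) ^ α := by
  have hs : 0 < ‖x‖ := norm_pos_iff.2 hx
  have hy : ‖y‖ ^ 2 = ‖x‖ ^ 2 + 2 * inner ℝ x (y - x) + ‖y - x‖ ^ 2 := by
    rw [← norm_add_sq_real, add_sub_cancel]
  have hi := abs_le.1 (abs_real_inner_le_norm x (y - x))
  set i := inner ℝ x (y - x)
  set t := r - ‖x‖ with ht
  have htpos : 0 < t := by linarith
  -- Linearising the square root at `‖x‖²` gives `‖y‖ ≤ ‖x‖ + R`. The two proximity hypotheses keep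
  -- `|R| ≤ (5/4)‖y-x‖`, hence `R < t`.
  set R := (i + ‖y - x‖ ^ 2 / 2) / ‖x‖ with hR
  have hn := norm_nonneg (y - x)
  have hRu : R ≤ 5 / 4 * ‖y - x‖ := by
    rw [hR, div_le_iff₀ hs]; nlinarith
  have hRl : -(5 / 4 * ‖y - x‖) ≤ R := by
    rw [hR, le_div_iff₀ hs]; nlinarith
  have hR2 : R ^ 2 ≤ 2 * ‖y - x‖ ^ 2 := by nlinarith
  have hRt : R < t := by linarith
  have hyR : ‖y‖ ≤ ‖x‖ + R := by
    have : R * ‖x‖ = i + ‖y - x‖ ^ 2 / 2 := by rw [hR]; field_simp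
    nlinarith [sq_nonneg (‖y‖ - ‖x‖)]
  calc _ ≤ t ^ α - α * t ^ (α - 1) * R - (1 - α) * t ^ (α - 2) * R ^ 2 := by
        have := mul_le_mul_of_nonneg_left hR2
          (mul_nonneg (sub_nonneg.2 hα1) (Real.rpow_nonneg htpos.le (α - 2)))
        have h3 : α * t ^ (α - 1) * R = α * t ^ (α - 1) / ‖x‖ * (i + ‖y - x‖ ^ 2 / 2) := by
          rw [hR]; ring
        rw [h3]; linarith
    _ ≤ (t - R) ^ α := rpow_sub_ge hα hα1 htpos hRt
    _ ≤ _ := Real.rpow_le_rpow (by linarith) (by linarith) hα.le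

/-- This controls the tangential curvature of the outer term, which mixes the distance to the centre
with the distance to the sphere. -/
lemma rpow_div_le {α s t : ℝ} (hα1 : α ≤ 1) (hs : 0 < s) (ht : 0 < t) :
    t ^ (α - 1) / s ≤ s ^ (α - 2) + t ^ (α - 2) := by
  have e : ∀ b : ℝ, 0 < b → b ^ (α - 2) = b ^ (α - 1) / b := by
    intro b hb
    rw [show α - 2 = (α - 1) - 1 by ring, Real.rpow_sub hb (α - 1), Real.rpow_one]
  have ps := Real.rpow_pos_of_pos hs (α - 2)
  have pt := Real.rpow_pos_of_pos ht (α - 2)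
  rcases le_total t s with h | h
  · have : t ^ (α - 1) / s ≤ t ^ (α - 1) / t :=
      div_le_div_of_nonneg_left (Real.rpow_nonneg ht.le _) ht h
    rw [← e t ht] at this; linarith
  · have : t ^ (α - 1) / s ≤ s ^ (α - 1) / s :=
      div_le_div_of_nonneg_right (Real.rpow_le_rpow_of_nonpos hs h (by linarith)) hs.le
    rw [← e s hs] at this; linarith

/-- The slope of the barrier. -/
noncomputable def barrierSlope (α B r : ℝ) (x : E) : E :=
  (B * (‖x‖ ^ (α - 1) + (r - ‖x‖) ^ (α - 1)) / ‖x‖) • x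

/-- The singular term at the centre is bounded globally. The outer term is convex in the radius, so
its bound holds only while `y` stays within half the distance to both singular sets. -/
lemma barrierProfile_le_paraboloid {α B r : ℝ} (hα : 0 < α) (hα1 : α ≤ 1) (hB : 0 ≤ B) {x : E}
    (hx : x ≠ 0) (hxr : ‖x‖ < r) :
    ∀ᶠ y in 𝓝 x, barrierProfile α B r ‖y‖ ≤ barrierProfile α B r ‖x‖ +
      inner ℝ (barrierSlope α B r x) (y - x) + barrierCurv α B r x / 2 * ‖y - x‖ ^ 2 := by
  have hs : 0 < ‖x‖ := norm_pos_iff.2 hx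
  have htpos : 0 < r - ‖x‖ := by linarith
  filter_upwards [closedBall_mem_nhds x (half_pos hs), closedBall_mem_nhds x (half_pos htpos)]
    with y h1 h2
  rw [mem_closedBall, dist_eq_norm] at h1 h2
  have A := norm_rpow_le_paraboloid hα hα1 hx y
  have D := rpow_sub_norm_ge_paraboloid hα hα1 hx hxr h1 h2
  have F := rpow_div_le (s := ‖x‖) (t := r - ‖x‖) hα1 hs htpos
  have ps := Real.rpow_pos_of_pos hs (α - 2)
  have pt := Real.rpow_pos_of_pos htpos (α - 2)
  have e : ‖x‖ ^ (α - 1) = ‖x‖ ^ (α - 2) * ‖x‖ := by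
    rw [← Real.rpow_add_one hs.ne']; congr 1; ring
  unfold barrierProfile barrierSlope barrierCurv
  rw [real_inner_smul_left, e]
  set i := inner ℝ x (y - x)
  set q := ‖y - x‖ ^ 2 with hq
  have hq0 : 0 ≤ q := by positivity
  set t := r - ‖x‖
  set S := ‖x‖ ^ (α - 2)
  set T := t ^ (α - 2)
  have hBα : 0 ≤ B / α := by positivity
  have key : ‖y‖ ^ α + r ^ α - (r - ‖y‖) ^ α ≤ ‖x‖ ^ α + r ^ α - t ^ α
      + α * (S + t ^ (α - 1) / ‖x‖) * i + α * (1 + 2 / α) * (S + T) * q := by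
    have h3 : α * (t ^ (α - 1) / ‖x‖) * (q / 2) ≤ α * (S + T) * (q / 2) := by gcongr
    have h4 : 2 * (1 - α) * T * q ≤ 2 * (S + T) * q := by
      have : 2 * (1 - α) * T ≤ 2 * (S + T) := by nlinarith
      gcongr
    have h5 : α * (1 + 2 / α) * (S + T) * q = α * (S + T) * q + 2 * (S + T) * q := by field_simp
    have h6 : α * t ^ (α - 1) / ‖x‖ * (i + q / 2)
      = α * (t ^ (α - 1) / ‖x‖) * i + α * (t ^ (α - 1) / ‖x‖) * (q / 2) := by ring
    have h7 : 0 ≤ α * T * q := by positivity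
    rw [h5]; nlinarith
  calc _ ≤ B / α * (‖x‖ ^ α + r ^ α - t ^ α
      + α * (S + t ^ (α - 1) / ‖x‖) * i + α * (1 + 2 / α) * (S + T) * q) :=
        mul_le_mul_of_nonneg_left key hBα
    _ = _ := by field_simp; ring

/-- A constant `B` for which the barrier is a strict supersolution. -/
lemma exists_barrier_constant {α m K₁ C Θ : ℝ} (hα : 0 < α) (hα1 : α ≤ 1) (hm : 2 < m)
    (hαm : (1 - α) * m = 2 - α) (hK₁ : 0 < K₁) (hC : 0 ≤ C) (hΘ : 0 ≤ Θ) :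
    ∃ B : ℝ, 0 < B ∧ ∀ r ≤ (1 : ℝ), ∀ x : E, x ≠ 0 → ‖x‖ < r →
      C + 1 + Θ * barrierCurv α B r x ≤ K₁ * ‖barrierSlope α B r x‖ ^ m := by
  set D := Θ * (2 + 4 / α) + C + 1 with hD
  have hDpos : 0 < D := by positivity
  -- `B ≥ 1` gives `B^m ≥ B²`, one power of `B` more than the curvature carries; `D/K₁` makes that
  -- power sufficient. The bound `r ≤ 1` gives `S ≥ 1`, so the constants are absorbed too.
  refine ⟨max 1 (D / K₁), by positivity, fun r hr x hx hxr => ?_⟩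
  set B := max 1 (D / K₁)
  have hB1 : 1 ≤ B := le_max_left _ _
  have hBD : D ≤ K₁ * B := by
    have : D / K₁ ≤ B := le_max_right _ _
    rw [div_le_iff₀ hK₁] at this; linarith
  have hs : 0 < ‖x‖ := norm_pos_iff.2 hx
  have htpos : 0 < r - ‖x‖ := by linarith
  set t := r - ‖x‖
  set S := ‖x‖ ^ (α - 2)
  set T := t ^ (α - 2)
  have hS : 1 ≤ S := Real.one_le_rpow_of_pos_of_le_one_of_nonpos hs (by linarith) (by linarith)
  have hT : 0 < T := Real.rpow_pos_of_pos htpos _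
  have e1 : ∀ b : ℝ, 0 < b → b ^ (α - 2) = (b ^ (α - 1)) ^ m := by
    intro b hb
    rw [← Real.rpow_mul hb.le]; congr 1; linarith
  have p1 := Real.rpow_pos_of_pos hs (α - 1)
  have p2 := Real.rpow_pos_of_pos htpos (α - 1)
  have hnorm : ‖barrierSlope α B r x‖ = B * (‖x‖ ^ (α - 1) + t ^ (α - 1)) := by
    unfold barrierSlope
    rw [norm_smul, Real.norm_of_nonneg (by positivity)]
    field_simp; rfl
  have hpow : B ^ 2 * (S + T) ≤ ‖barrierSlope α B r x‖ ^ m := by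
    rw [hnorm, Real.mul_rpow (by positivity) (by positivity)]
    have h1 : B ^ 2 ≤ B ^ m := by
      rw [← Real.rpow_two]; exact Real.rpow_le_rpow_of_exponent_le hB1 hm.le
    have h2 : S + T ≤ (‖x‖ ^ (α - 1) + t ^ (α - 1)) ^ m := by
      have := Real.add_rpow_le_rpow_add p1.le p2.le (by linarith : 1 ≤ m)
      rwa [← e1 _ hs, ← e1 _ htpos] at this
    exact mul_le_mul h1 h2 (by positivity) (by positivity)
  have h3 : C + 1 + Θ * barrierCurv α B r x ≤ D * B * (S + T) := by
    have : Θ * barrierCurv α B r x = Θ * (2 + 4 / α) * (B * (S + T)) := by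
      unfold barrierCurv; ring
    rw [this, hD]
    have h5 : 1 ≤ B * (S + T) := by nlinarith
    nlinarith
  calc _ ≤ D * B * (S + T) := h3
    _ ≤ (K₁ * B) * B * (S + T) := by gcongr
    _ = K₁ * (B ^ 2 * (S + T)) := by ring
    _ ≤ _ := mul_le_mul_of_nonneg_left hpow hK₁.le

/-- No differentiable function touches the barrier from below at a boundary point. -/
lemma not_isLocalMinOn_barrierProfile_sub {α B r : ℝ} (hα : 0 < α) (hα1 : α < 1) (hB : 0 < B)
    (hr : 0 < r) {z : E} (hz : ‖z‖ = r) {φ : E → ℝ} (hφ : DifferentiableAt ℝ φ z) :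
    ¬ IsLocalMinOn (fun y => barrierProfile α B r ‖y‖ - φ y) (closedBall 0 r \ {0}) z := by
  intro hmin
  obtain ⟨C, hC⟩ := hφ.isBigO_sub.bound
  -- Moving radially inward, the outer term makes the barrier drop at least like `t^α`, while `φ`
  -- varies only by `O(t)`.
  have hline : Tendsto (fun t : ℝ => (1 - t) • z) (𝓝[>] 0) (𝓝[closedBall 0 r \ {0}] z) := by
    apply tendsto_nhdsWithin_iff.2 ⟨?_, ?_⟩
    · have : Continuous fun t : ℝ => (1 - t) • z := by fun_prop
      have h := (this.tendsto 0).mono_left (nhdsWithin_le_nhds (s := Ioi 0))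
      simpa using h
    · filter_upwards [Ioo_mem_nhdsGT (zero_lt_one)] with t ht
      have hz0 : z ≠ 0 := by rintro rfl; simp at hz; linarith
      refine ⟨?_, ?_⟩
      · rw [mem_closedBall_zero_iff, norm_smul, Real.norm_of_nonneg (by linarith [ht.2]), hz]
        nlinarith [ht.1]
      · simp only [mem_singleton_iff, smul_eq_zero, not_or]
        exact ⟨by linarith [ht.2], hz0⟩
  have h1 := hline.eventually hmin
  have h2 := (tendsto_nhdsWithin_iff.1 hline).1.eventually hC
  have h3 : Tendsto (fun t : ℝ => t ^ (α - 1)) (𝓝[>] 0) atTop :=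
    tendsto_rpow_neg_nhdsGT_zero (by linarith)
  have h4 := h3.eventually (eventually_gt_atTop (C * r / (B / α * r ^ α)))
  obtain ⟨t, h1, h2, h4, ht⟩ :=
    (h1.and (h2.and (h4.and (Ioo_mem_nhdsGT (zero_lt_one' ℝ))))).exists
  have ht0 : 0 < t := ht.1
  have hnorm : ‖(1 - t) • z‖ = (1 - t) * r := by
    rw [norm_smul, Real.norm_of_nonneg (by linarith [ht.2]), hz]
  have hsub : ‖(1 - t) • z - z‖ = t * r := by
    rw [show (1 - t) • z - z = (-t) • z by module, norm_smul, norm_neg,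
      Real.norm_of_nonneg ht0.le, hz]
  rw [hsub, Real.norm_eq_abs] at h2
  have h2' := (abs_le.1 h2).1
  simp only [hnorm, hz] at h1
  unfold barrierProfile at h1
  have hmono : ((1 - t) * r) ^ α ≤ r ^ α :=
    Real.rpow_le_rpow (by nlinarith [ht.2]) (by nlinarith) hα.le
  have hz0 : (r - r) ^ α = 0 := by rw [sub_self, Real.zero_rpow hα.ne']
  have htr : (r - (1 - t) * r) ^ α = t * t ^ (α - 1) * r ^ α := by
    rw [show r - (1 - t) * r = t * r by ring, Real.mul_rpow ht0.le hr.le]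
    congr 1
    rw [mul_comm, ← Real.rpow_add_one ht0.ne']; simp
  rw [hz0, htr] at h1
  have hpos : 0 < B / α * r ^ α := by positivity
  rw [div_lt_iff₀ hpos] at h4
  have h5 := mul_le_mul_of_nonneg_left hmono (by positivity : 0 ≤ B / α)
  have h6 := mul_lt_mul_of_pos_left h4 ht0
  nlinarith
end

/-! ### Comparison of subsolutions with the barrier -/

section
variable {E : Type*} [NormedAddCommGroup E] [InnerProductSpace ℝ E]

/-- Every paraboloid `⟪p, ·⟫ + κ/2 ‖·‖²` touching `v` from above at a point of `A` satisfies
`K₁ ‖p‖ ^ m ≤ C + Θ κ`. -/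
def IsParaboloidSubsolution (K₁ m C Θ : ℝ) (A : Set E) (v : E → ℝ) : Prop :=
  ∀ x ∈ A, ∀ (p : E) (κ : ℝ), 0 ≤ κ →
    (∀ᶠ y in 𝓝 x, v y ≤ v x + inner ℝ p (y - x) + κ / 2 * ‖y - x‖ ^ 2) →
    K₁ * ‖p‖ ^ m ≤ C + Θ * κ

lemma IsParaboloidSubsolution.mono {K₁ m C Θ : ℝ} {A A' : Set E} {v : E → ℝ}
    (h : IsParaboloidSubsolution K₁ m C Θ A v) (hA : A' ⊆ A) :
    IsParaboloidSubsolution K₁ m C Θ A' v :=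
  fun x hx => h x (hA hx)

/-- A rescaled barrier cannot touch a subsolution from above. -/
lemma IsParaboloidSubsolution.not_touched_by_barrier {K₁ m C Θ α B r μ : ℝ} {A : Set E}
    {v : E → ℝ} (hv : IsParaboloidSubsolution K₁ m C Θ A v) (hm : 2 < m) (hC : 0 ≤ C) (hΘ : 0 ≤ Θ)
    (hα : 0 < α) (hα1 : α ≤ 1) (hB : 0 ≤ B) (hμ : 0 < μ) (hμ1 : μ ≤ 1)
    {x z : E} (hx : x ∈ A) (hz : z ≠ 0) (hzr : ‖z‖ < r)
    (hbar : C + 1 + Θ * barrierCurv α B r z ≤ K₁ * ‖barrierSlope α B r z‖ ^ m)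
    (hmax : ∀ᶠ y in 𝓝 x, v y - barrierProfile α B r ‖z + μ⁻¹ • (y - x)‖ ≤
      v x - barrierProfile α B r ‖z‖) : False := by
  set p := barrierSlope α B r z
  set κ := barrierCurv α B r z
  have hκ : 0 ≤ κ := barrierCurv_nonneg hα hB hzr.le
  have htend : Tendsto (fun y => z + μ⁻¹ • (y - x)) (𝓝 x) (𝓝 z) := by
    have : Continuous fun y => z + μ⁻¹ • (y - x) := by fun_prop
    simpa using this.tendsto x
  have hp := htend.eventually (barrierProfile_le_paraboloid hα hα1 hB hz hzr)
  have key := hv x hx (μ⁻¹ • p) (κ / μ ^ 2) (by positivity) (by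
    filter_upwards [hp, hmax] with y h1 h2
    rw [add_sub_cancel_left, real_inner_smul_right, norm_smul, mul_pow, Real.norm_eq_abs,
      sq_abs] at h1
    rw [real_inner_smul_left]
    have : κ / μ ^ 2 / 2 * ‖y - x‖ ^ 2 = κ / 2 * (μ⁻¹ ^ 2 * ‖y - x‖ ^ 2) := by field_simp
    rw [this]; linarith)
  rw [norm_smul, Real.norm_of_nonneg (by positivity), Real.mul_rpow (by positivity)
    (norm_nonneg _)] at key
  have hi : 1 ≤ μ⁻¹ := (one_le_inv₀ hμ).2 hμ1
  -- Dilation multiplies the curvature by `μ⁻²` and the gradient term by `μ⁻ᵐ`. As `m > 2` and `μ ≤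
  -- 1`, strictness survives.
  have h2 : (μ ^ 2)⁻¹ ≤ μ⁻¹ ^ m := by
    rw [← inv_pow, ← Real.rpow_two]
    exact Real.rpow_le_rpow_of_exponent_le hi hm.le
  have h3 : 1 ≤ (μ ^ 2)⁻¹ := by rw [← inv_pow]; exact one_le_pow₀ hi
  have h4 : 0 ≤ K₁ * ‖p‖ ^ m := by have := mul_nonneg hΘ hκ; linarith
  have h5 : (C + 1 + Θ * κ) * (μ ^ 2)⁻¹ ≤ K₁ * ‖p‖ ^ m * (μ ^ 2)⁻¹ :=
    mul_le_mul_of_nonneg_right hbar (by positivity)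
  have h8 : K₁ * (μ⁻¹ ^ m * ‖p‖ ^ m) = K₁ * ‖p‖ ^ m * μ⁻¹ ^ m := by ring
  have h7 : Θ * (κ / μ ^ 2) = Θ * κ * (μ ^ 2)⁻¹ := by ring
  rw [h7, h8] at key
  have h6 := mul_le_mul_of_nonneg_left h2 h4
  nlinarith

/-- If the bound fails at `y`, it still fails against `w(·/μ)` for some `μ < 1`. One maximises `v(x)
- w(z) - n‖x-μz‖²`: the dilation keeps `x` away from the outer sphere while `z` may reach it, where
the infinite slope excludes it. -/
theorem IsParaboloidSubsolution.le_add_barrier_zero [ProperSpace E] {K₁ m C Θ α B r M : ℝ}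
    {v : E → ℝ}
    (hm : 2 < m) (hC : 0 ≤ C) (hΘ : 0 ≤ Θ) (hα : 0 < α) (hα1 : α < 1) (hB : 0 < B)
    (hbar : ∀ x : E, x ≠ 0 → ‖x‖ < r →
      C + 1 + Θ * barrierCurv α B r x ≤ K₁ * ‖barrierSlope α B r x‖ ^ m)
    (hM : ∀ y ∈ ball (0 : E) r, v y ≤ M) (husc : UpperSemicontinuousOn v (ball 0 r))
    (hv : IsParaboloidSubsolution K₁ m C Θ (ball 0 r \ {0}) v) {y : E} (hy : y ∈ ball (0 : E) r) :
    v y ≤ v 0 + barrierProfile α B r ‖y‖ := by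
  by_contra! hlt
  have hyr : ‖y‖ < r := mem_ball_zero_iff.1 hy
  have hr : 0 < r := (norm_nonneg y).trans_lt hyr
  set w := barrierProfile α B r with hw
  have hwc : Continuous w := continuous_barrierProfile hα B r
  -- a dilation factor `μ < 1`
  obtain ⟨μ, ⟨hμ1, hμ2⟩, hμ0, hμr⟩ : ∃ μ : ℝ, (v 0 + w ‖μ⁻¹ • y‖ < v y ∧ ‖μ⁻¹ • y‖ < r) ∧
      0 < μ ∧ μ < 1 := by
    have hcont : ContinuousAt (fun μ : ℝ => ‖μ⁻¹ • y‖) 1 := by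
      fun_prop (disch := norm_num)
    have h1 : ∀ᶠ μ : ℝ in 𝓝 1, v 0 + w ‖μ⁻¹ • y‖ < v y := by
      have : ContinuousAt (fun μ : ℝ => v 0 + w ‖μ⁻¹ • y‖) 1 :=
        continuousAt_const.add (hwc.continuousAt.comp hcont)
      exact this.eventually_lt continuousAt_const (by simpa using hlt)
    have h2 : ∀ᶠ μ : ℝ in 𝓝 1, ‖μ⁻¹ • y‖ < r :=
      hcont.eventually_lt continuousAt_const (by simpa using hyr)
    have h3 := (h1.and h2).filter_mono (nhdsWithin_le_nhds (s := Iio 1))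
    exact (h3.and (Ioo_mem_nhdsLT (zero_lt_one' ℝ))).exists
  set y₀ := μ⁻¹ • y with hy₀
  have hμy : μ • y₀ = y := by rw [hy₀, smul_inv_smul₀ hμ0.ne']
  -- Halfway between `μr` and `r`: the maximisation then takes place on a compact ball where `v` is
  -- upper semicontinuous, with room left around the dilated ball.
  set ρ := (1 + μ) / 2 * r with hρ
  have hρr : ρ < r := by nlinarith
  have hμρ : μ * r < ρ := by nlinarith
  -- Upper semicontinuity at the centre; this excludes both `x = 0` and `z = 0` at the maximum.
  obtain ⟨ε, hε, hεv⟩ : ∃ ε > 0, ∀ x ∈ ball (0 : E) r, ‖x‖ < ε → v x < v y - w ‖y₀‖ := by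
    have h := husc 0 (mem_ball_self hr) (v y - w ‖y₀‖) (by linarith)
    obtain ⟨ε, hε, h⟩ := Metric.mem_nhdsWithin_iff.1 h
    exact ⟨ε, hε, fun x hx hxe => h ⟨mem_ball_zero_iff.2 hxe, hx⟩⟩
  set τ := min ε (ρ - μ * r) with hτ
  have hτ0 : 0 < τ := lt_min hε (by linarith)
  set D := M + w ‖y₀‖ - v y + 1
  have hwn : ∀ z : E, ‖z‖ ≤ r → 0 ≤ w ‖z‖ := fun z hz =>
    barrierProfile_nonneg hα hB.le (norm_nonneg z) hz
  have hD : 0 < D := by have := hM y hy; have := hwn y₀ hμ2.le; linarith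
  -- The competitor `(y, y₀)` has zero penalty, so the penalty at the maximum is below `D`; this `n`
  -- then forces `‖x-μz‖ < τ`.
  set n := D / τ ^ 2 with hn
  have hn0 : 0 < n := by positivity
  set X : Set (E × E) := closedBall 0 ρ ×ˢ closedBall 0 r
  have hX : IsCompact X := (isCompact_closedBall _ _).prod (isCompact_closedBall _ _)
  have hyX : (y, y₀) ∈ X := by
    refine ⟨mem_closedBall_zero_iff.2 ?_, mem_closedBall_zero_iff.2 hμ2.le⟩
    show ‖y‖ ≤ ρ
    rw [← hμy, norm_smul, Real.norm_of_nonneg hμ0.le]; nlinarith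
  have hPsi : UpperSemicontinuousOn
      (fun q : E × E => v q.1 + -(w ‖q.2‖ + n * ‖q.1 - μ • q.2‖ ^ 2)) X := by
    refine UpperSemicontinuousOn.add ?_ ((Continuous.upperSemicontinuous ?_).upperSemicontinuousOn X)
    · exact (husc.mono (closedBall_subset_ball hρr)).comp continuous_fst.continuousOn
        (fun q hq => hq.1)
    · fun_prop
  obtain ⟨⟨x, z⟩, ⟨hxρ, hzr⟩, hmax⟩ := hPsi.exists_isMaxOn ⟨_, hyX⟩ hX
  replace hxρ : ‖x‖ ≤ ρ := mem_closedBall_zero_iff.1 hxρ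
  replace hzr : ‖z‖ ≤ r := mem_closedBall_zero_iff.1 hzr
  have hmax' : ∀ x' z' : E, ‖x'‖ ≤ ρ → ‖z'‖ ≤ r →
      v x' - w ‖z'‖ - n * ‖x' - μ • z'‖ ^ 2 ≤ v x - w ‖z‖ - n * ‖x - μ • z‖ ^ 2 := by
    intro x' z' h1 h2
    have : (v x' + -(w ‖z'‖ + n * ‖x' - μ • z'‖ ^ 2)) ≤
        v x + -(w ‖z‖ + n * ‖x - μ • z‖ ^ 2) :=
      hmax (a := (x', z')) ⟨mem_closedBall_zero_iff.2 h1, mem_closedBall_zero_iff.2 h2⟩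
    linarith
  have hval : v y - w ‖y₀‖ ≤ v x - w ‖z‖ - n * ‖x - μ • z‖ ^ 2 := by
    have := hmax' y y₀ (mem_closedBall_zero_iff.1 hyX.1) hμ2.le
    simpa [hμy] using this
  have hxr : x ∈ ball (0 : E) r := mem_ball_zero_iff.2 (hxρ.trans_lt hρr)
  have hclose : ‖x - μ • z‖ < τ := by
    have h1 := hM x hxr
    have h2 := hwn z hzr
    have h3 : n * ‖x - μ • z‖ ^ 2 < n * τ ^ 2 := by
      have : n * τ ^ 2 = D := by rw [hn]; field_simp
      rw [this]; linarith
    exact lt_of_pow_lt_pow_left₀ 2 hτ0.le (lt_of_mul_lt_mul_left h3 hn0.le)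
  have hpen : 0 ≤ n * ‖x - μ • z‖ ^ 2 := by positivity
  have hx0 : x ≠ 0 := by
    rintro rfl
    have := hwn z hzr
    have := hεv 0 hxr (by simpa using hε)
    linarith
  have hxρ' : ‖x‖ < ρ := by
    have h1 : ‖x‖ ≤ ‖x - μ • z‖ + ‖μ • z‖ := by
      simpa using norm_add_le (x - μ • z) (μ • z)
    rw [norm_smul, Real.norm_of_nonneg hμ0.le] at h1
    have h2 : τ ≤ ρ - μ * r := min_le_right _ _
    nlinarith
  have hz0 : z ≠ 0 := by
    rintro rfl
    have h1 : ‖x‖ < ε := by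
      simpa using hclose.trans_le (min_le_left _ _)
    have h2 := hεv x hxr h1
    have h3 := hwn 0 hzr
    linarith
  -- For `‖z‖ < r`, moving `x` and `z` together with `x-μz` fixed cancels the penalty and makes a
  -- rescaled barrier touch `v`. For `‖z‖ = r`, freezing `x` makes a smooth function touch the
  -- barrier from below on the sphere.
  rcases hzr.lt_or_eq with hzr' | hzr'
  · refine hv.not_touched_by_barrier hm hC hΘ hα hα1.le hB.le hμ0 hμr.le ⟨hxr, hx0⟩ hz0 hzr'
      (hbar z hz0 hzr') ?_
    have e1 : ∀ᶠ y in 𝓝 x, ‖y‖ < ρ :=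
      continuous_norm.continuousAt.eventually_lt continuousAt_const hxρ'
    have e2 : ∀ᶠ y in 𝓝 x, ‖z + μ⁻¹ • (y - x)‖ < r := by
      have : Continuous fun y => ‖z + μ⁻¹ • (y - x)‖ := by fun_prop
      exact this.continuousAt.eventually_lt continuousAt_const (by simpa using hzr')
    filter_upwards [e1, e2] with x' h1 h2
    have h3 := hmax' x' _ h1.le h2.le
    have h4 : x' - μ • (z + μ⁻¹ • (x' - x)) = x - μ • z := by
      rw [smul_add, smul_inv_smul₀ hμ0.ne']; abel
    rw [h4] at h3
    linarith
  · refine not_isLocalMinOn_barrierProfile_sub (φ := fun z' => -(n * ‖x - μ • z'‖ ^ 2)) hα hα1 hB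
      hr hzr' ?_ ?_
    · have : Differentiable ℝ fun z' : E => x - μ • z' := by fun_prop
      exact (((this z).norm_sq ℝ).const_mul n).neg
    · filter_upwards [self_mem_nhdsWithin] with z' hz'
      have := hmax' x z' hxρ (mem_closedBall_zero_iff.1 hz'.1)
      linarith

theorem IsParaboloidSubsolution.le_add_barrier [ProperSpace E] {K₁ m C Θ α B r M : ℝ}
    {v : E → ℝ} {x₀ : E}
    (hm : 2 < m) (hC : 0 ≤ C) (hΘ : 0 ≤ Θ) (hα : 0 < α) (hα1 : α < 1) (hB : 0 < B)
    (hbar : ∀ x : E, x ≠ 0 → ‖x‖ < r →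
      C + 1 + Θ * barrierCurv α B r x ≤ K₁ * ‖barrierSlope α B r x‖ ^ m)
    (hM : ∀ y ∈ ball x₀ r, v y ≤ M) (husc : UpperSemicontinuousOn v (ball x₀ r))
    (hv : IsParaboloidSubsolution K₁ m C Θ (ball x₀ r) v) {y : E} (hy : y ∈ ball x₀ r) :
    v y ≤ v x₀ + barrierProfile α B r ‖y - x₀‖ := by
  have hmaps : MapsTo (fun y => x₀ + y) (ball 0 r) (ball x₀ r) := by
    intro y hy
    simpa [mem_ball, dist_eq_norm] using hy
  have hcont : Continuous fun y : E => x₀ + y := by fun_prop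
  have key := IsParaboloidSubsolution.le_add_barrier_zero (v := fun y => v (x₀ + y)) (M := M)
    (y := y - x₀) hm hC hΘ hα hα1 hB hbar (fun y hy => hM _ (hmaps hy))
    (husc.comp hcont.continuousOn hmaps) ?_ (by simpa [mem_ball, dist_eq_norm] using hy)
  · simpa using key
  · intro x hx p κ hκ h
    refine hv (x₀ + x) (hmaps hx.1) p κ hκ ?_
    have ht : Tendsto (fun y : E => y - x₀) (𝓝 (x₀ + x)) (𝓝 x) := by
      have : Continuous fun y : E => y - x₀ := by fun_prop
      simpa using this.tendsto (x₀ + x)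
    filter_upwards [ht.eventually h] with y h
    rw [add_sub_cancel] at h
    rwa [← sub_sub]
end

/-! ### Second-order conditions and paraboloid test functions -/

/-- A negative second derivative would also give a local maximum, so `f` would be locally constant
and its second derivative zero. -/
lemma IsLocalMin.deriv_deriv_nonneg {f : ℝ → ℝ} {x : ℝ} (h : IsLocalMin f x)
    (hf : ContinuousAt f x) : 0 ≤ deriv (deriv f) x := by
  by_contra! hneg
  have hmax := isLocalMax_of_deriv_deriv_neg hneg h.deriv_eq_zero hf
  have hconst : f =ᶠ[𝓝 x] fun _ => f x := by
    filter_upwards [h, hmax] with y h1 h2 using le_antisymm h2 h1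
  have := hconst.deriv.deriv_eq
  simp at this
  linarith

section Paraboloid
variable {N : ℕ}

lemma contDiff_paraboloid (x p : Eucl N) (κ : ℝ) :
    ContDiff ℝ 2 fun y : Eucl N => inner ℝ p (y - x) + κ / 2 * ‖y - x‖ ^ 2 := by
  have h : ContDiff ℝ 2 fun y : Eucl N => y - x := by fun_prop
  exact (contDiff_const.inner ℝ h).add (contDiff_const.mul (h.norm_sq ℝ))

lemma fderiv_paraboloid (x p : Eucl N) (κ : ℝ) :
    fderiv ℝ (fun y : Eucl N => inner ℝ p (y - x) + κ / 2 * ‖y - x‖ ^ 2) =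
      fun y => innerSL ℝ p + κ • innerSL ℝ (y - x) := by
  ext1 y
  have h : HasFDerivAt (fun y : Eucl N => y - x) (ContinuousLinearMap.id ℝ (Eucl N)) y :=
    (hasFDerivAt_id y).sub_const x
  have h1 := (hasFDerivAt_const p y).inner ℝ h
  have h2 := h.norm_sq.const_mul (κ / 2)
  refine HasFDerivAt.fderiv ((h1.add h2).congr_fderiv ?_)
  ext e
  simp
  ring

lemma gradient_paraboloid (x p : Eucl N) (κ : ℝ) :
    gradient (fun y : Eucl N => inner ℝ p (y - x) + κ / 2 * ‖y - x‖ ^ 2) x = p := by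
  rw [gradient, fderiv_paraboloid]
  simp only [sub_self, map_zero, smul_zero, add_zero]
  exact (InnerProductSpace.toDual ℝ (Eucl N)).symm_apply_apply p

lemma hessian_paraboloid (x p : Eucl N) (κ : ℝ) :
    hessian (fun y : Eucl N => inner ℝ p (y - x) + κ / 2 * ‖y - x‖ ^ 2) x =
      κ • (1 : Matrix (Fin N) (Fin N) ℝ) := by
  ext i j
  rw [hessian, fderiv_paraboloid]
  have h : HasFDerivAt (fun y : Eucl N => innerSL ℝ p + κ • innerSL ℝ (y - x))
      (κ • (innerSL ℝ : Eucl N →L[ℝ] Eucl N →L[ℝ] ℝ)) x := by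
    have h1 : HasFDerivAt (fun y : Eucl N => y - x) (ContinuousLinearMap.id ℝ (Eucl N)) x :=
      (hasFDerivAt_id x).sub_const x
    have h2 := ((innerSL ℝ : Eucl N →L[ℝ] Eucl N →L[ℝ] ℝ).hasFDerivAt.comp x h1).const_smul κ
    exact (h2.const_add (innerSL ℝ p))
  rw [h.fderiv]
  change κ * inner ℝ (EuclideanSpace.single i 1 : Eucl N) (EuclideanSpace.single j 1) = _
  simp [Matrix.one_apply, EuclideanSpace.inner_single_left]

lemma quadratic_hessian (φ : Eucl N → ℝ) (x : Eucl N) (v : Fin N → ℝ) :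
    v ⬝ᵥ (hessian φ x).mulVec v =
      fderiv ℝ (fderiv ℝ φ) x (WithLp.toLp 2 v) (WithLp.toLp 2 v) := by
  have hv : WithLp.toLp 2 v = ∑ i, v i • (EuclideanSpace.single i 1 : Eucl N) := by
    ext j
    simp [Finset.sum_apply, Pi.single_apply]
  rw [hv]
  simp only [map_sum, map_smul, sum_apply, smul_apply,
    dotProduct, Matrix.mulVec, hessian, Matrix.of_apply, smul_eq_mul, Finset.mul_sum]
  rw [Finset.sum_comm]
  refine Finset.sum_congr rfl fun i _ => Finset.sum_congr rfl fun j _ => by ring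

lemma hessian_isSymm {φ : Eucl N → ℝ} (hφ : ContDiff ℝ 2 φ) (x : Eucl N) :
    (hessian φ x).IsSymm := by
  have h := (hφ.contDiffAt (x := x)).isSymmSndFDerivAt (by simp)
  ext i j
  exact h _ _

/-- First and second order conditions for a function touched from above by a paraboloid. -/
lemma touching_paraboloid {φ w : Eucl N → ℝ} (hφ : ContDiff ℝ 2 φ) {x p : Eucl N} {κ : ℝ}
    (hw : ∀ᶠ y in 𝓝 x, w y ≤ w x + inner ℝ p (y - x) + κ / 2 * ‖y - x‖ ^ 2)
    (hmin : IsLocalMin (fun y => w y - φ y) x) :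
    gradient φ x = p ∧ (κ • (1 : Matrix (Fin N) (Fin N) ℝ) - hessian φ x).PosSemidef := by
  have hφd : Differentiable ℝ φ := hφ.differentiable (by norm_num)
  have hφd2 : Differentiable ℝ (fderiv ℝ φ) :=
    (hφ.fderiv_right (m := 1) (by norm_num)).differentiable (by norm_num)
  -- The function `w` need not be differentiable, but the paraboloid lies above it with equality at
  -- `x`, so paraboloid minus `φ` inherits the local minimum. It is tested along lines.
  set F : Eucl N → ℝ → ℝ := fun e t => t * inner ℝ p e + t ^ 2 * (κ / 2 * ‖e‖ ^ 2) - φ (x + t • e)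
  have hline : ∀ e : Eucl N, ∀ t, HasDerivAt (fun t : ℝ => x + t • e) e t := by
    intro e t
    simpa using ((hasDerivAt_id t).smul_const e).const_add x
  have hF : ∀ e t, HasDerivAt (F e)
      (inner ℝ p e + 2 * t * (κ / 2 * ‖e‖ ^ 2) - fderiv ℝ φ (x + t • e) e) t := by
    intro e t
    have h1 : HasDerivAt (fun t : ℝ => t * inner ℝ p e) (inner ℝ p e) t := by
      simpa using (hasDerivAt_id t).mul_const (inner ℝ p e)
    have h2 : HasDerivAt (fun t : ℝ => t ^ 2 * (κ / 2 * ‖e‖ ^ 2)) (2 * t * (κ / 2 * ‖e‖ ^ 2)) t := by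
      simpa using (hasDerivAt_pow 2 t).mul_const (κ / 2 * ‖e‖ ^ 2)
    exact (h1.add h2).sub ((hφd _).hasFDerivAt.comp_hasDerivAt t (hline e t))
  have hFmin : ∀ e, IsLocalMin (F e) 0 := by
    intro e
    have ht : Tendsto (fun t : ℝ => x + t • e) (𝓝 0) (𝓝 x) := by
      have : Continuous fun t : ℝ => x + t • e := by fun_prop
      simpa using this.tendsto 0
    filter_upwards [ht.eventually hw, ht.eventually hmin] with t h1 h2
    simp only [F, zero_smul, add_zero, add_sub_cancel_left, real_inner_smul_right, norm_smul,
      mul_pow, Real.norm_eq_abs, sq_abs] at h1 ⊢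
    linarith
  have hgrad : ∀ e, fderiv ℝ φ x e = inner ℝ p e := by
    intro e
    have h1 := (hFmin e).hasDerivAt_eq_zero (hF e 0)
    simp at h1
    linarith
  have hhess : ∀ e, fderiv ℝ (fderiv ℝ φ) x e e ≤ κ * ‖e‖ ^ 2 := by
    intro e
    have h1 := (hFmin e).deriv_deriv_nonneg (hF e 0).continuousAt
    have h2 : deriv (F e) = fun t =>
        inner ℝ p e + 2 * t * (κ / 2 * ‖e‖ ^ 2) - fderiv ℝ φ (x + t • e) e :=
      funext fun t => (hF e t).deriv
    have h3 : HasDerivAt (fun t : ℝ => fderiv ℝ φ (x + t • e) e)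
        (fderiv ℝ (fderiv ℝ φ) (x + (0 : ℝ) • e) e e) 0 := by
      have := (hφd2 (x + (0 : ℝ) • e)).hasFDerivAt.comp_hasDerivAt (0 : ℝ) (hline e 0)
      exact (ContinuousLinearMap.apply ℝ ℝ e).hasFDerivAt.comp_hasDerivAt (0 : ℝ) this
    have h4 : HasDerivAt (fun t : ℝ => inner ℝ p e + 2 * t * (κ / 2 * ‖e‖ ^ 2))
        (2 * (κ / 2 * ‖e‖ ^ 2)) 0 := by
      have := (((hasDerivAt_id (0 : ℝ)).const_mul 2).mul_const (κ / 2 * ‖e‖ ^ 2)).const_add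
        (inner ℝ p e)
      simpa using this
    rw [h2] at h1
    have h5 := h1.trans_eq (h4.sub h3).deriv
    rw [zero_smul, add_zero] at h5
    linarith
  refine ⟨?_, Matrix.PosSemidef.of_dotProduct_mulVec_nonneg ?_ fun v => ?_⟩
  · refine ext_inner_right ℝ fun e => ?_
    rw [inner_gradient_left, hgrad]
  · have h := hessian_isSymm hφ x
    rw [Matrix.IsHermitian, Matrix.conjTranspose_eq_transpose_of_trivial, Matrix.transpose_sub,
      h.eq, Matrix.transpose_smul, Matrix.transpose_one]
  · have h := hhess (WithLp.toLp 2 v)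
    rw [← quadratic_hessian, EuclideanSpace.norm_sq_eq] at h
    simp only [star_trivial, Matrix.sub_mulVec, dotProduct_sub, Matrix.smul_mulVec,
      Matrix.one_mulVec, dotProduct_smul, smul_eq_mul, sub_nonneg]
    refine h.trans_eq ?_
    simp [dotProduct, sq]

end Paraboloid

/-! ### The extremal operator -/

section Elliptic
variable {N : ℕ}

/-- Nonnegative matrices with entries bounded by `Λ`. -/
def boundedNonnegMatrices (N : ℕ) (Λ : ℝ) : Set (Matrix (Fin N) (Fin N) ℝ) :=
  {A | (∀ i j, |A i j| ≤ Λ) ∧ ∀ p : Fin N → ℝ, 0 ≤ A.mulVec p ⬝ᵥ p}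

lemma isCompact_boundedNonnegMatrices (N : ℕ) (Λ : ℝ) :
    IsCompact (boundedNonnegMatrices N Λ) := by
  have hK : IsCompact (Set.pi univ fun _ : Fin N => Set.pi univ fun _ : Fin N => Icc (-Λ) Λ) :=
    isCompact_univ_pi fun _ => isCompact_univ_pi fun _ => isCompact_Icc
  refine IsCompact.of_isClosed_subset (X := Matrix (Fin N) (Fin N) ℝ) hK ?_ ?_
  · have h1 : IsClosed {A : Matrix (Fin N) (Fin N) ℝ | ∀ i j, |A i j| ≤ Λ} := by
      simp only [ofPred_forall]
      refine isClosed_iInter fun i => isClosed_iInter fun j => ?_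
      exact isClosed_le (by fun_prop) continuous_const
    have h2 : IsClosed {A : Matrix (Fin N) (Fin N) ℝ | ∀ p : Fin N → ℝ, 0 ≤ A.mulVec p ⬝ᵥ p} := by
      simp only [ofPred_forall]
      refine isClosed_iInter fun p => isClosed_le continuous_const ?_
      exact (continuous_id.matrix_mulVec continuous_const).dotProduct continuous_const
    exact h1.inter h2
  · exact fun A hA i _ j _ => abs_le.1 (hA.1 i j)

lemma zero_mem_boundedNonnegMatrices {Λ : ℝ} (hΛ : 0 ≤ Λ) :
    (0 : Matrix (Fin N) (Fin N) ℝ) ∈ boundedNonnegMatrices N Λ :=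
  ⟨fun i j => by simpa using hΛ, fun p => by simp⟩

lemma trace_le_of_mem_boundedNonnegMatrices {Λ : ℝ} {A : Matrix (Fin N) (Fin N) ℝ}
    (hA : A ∈ boundedNonnegMatrices N Λ) : A.trace ≤ N * Λ := by
  calc A.trace ≤ ∑ _i : Fin N, Λ := Finset.sum_le_sum fun i _ => (abs_le.1 (hA.1 i i)).2
    _ = N * Λ := by simp

/-- Writing `P` as a sum of terms `v vᵀ` turns the trace into a sum of `Av·v`; symmetry of `A` is
not needed. -/
lemma trace_mul_nonneg {A P : Matrix (Fin N) (Fin N) ℝ}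
    (hA : ∀ p : Fin N → ℝ, 0 ≤ A.mulVec p ⬝ᵥ p) (hP : P.PosSemidef) : 0 ≤ (A * P).trace := by
  obtain ⟨k, v, rfl⟩ := Matrix.posSemidef_iff_eq_sum_vecMulVec.1 hP
  rw [Finset.mul_sum, Matrix.trace_sum]
  refine Finset.sum_nonneg fun i _ => ?_
  rw [Matrix.mul_vecMulVec, Matrix.trace_vecMulVec, star_trivial]
  exact hA _

/-- The supremum of `Tr(A M)` over the nonnegative matrices `A` with entries bounded by `Λ`. -/
noncomputable def maximalTrace (Λ : ℝ) (M : Matrix (Fin N) (Fin N) ℝ) : ℝ :=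
  sSup ((fun A => (A * M).trace) '' boundedNonnegMatrices N Λ)

lemma continuous_maximalTrace (Λ : ℝ) :
    Continuous (maximalTrace Λ : Matrix (Fin N) (Fin N) ℝ → ℝ) := by
  refine IsCompact.continuous_sSup (f := fun M A => (A * M).trace)
    (isCompact_boundedNonnegMatrices N Λ) ?_
  exact (continuous_snd.matrix_mul continuous_fst).matrix_trace

lemma trace_mul_le_maximalTrace {Λ : ℝ} {A : Matrix (Fin N) (Fin N) ℝ}
    (hA : A ∈ boundedNonnegMatrices N Λ) (M : Matrix (Fin N) (Fin N) ℝ) :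
    (A * M).trace ≤ maximalTrace Λ M := by
  refine le_csSup ?_ (mem_image_of_mem _ hA)
  refine ((isCompact_boundedNonnegMatrices N Λ).image ?_).bddAbove
  exact (continuous_id.matrix_mul continuous_const).matrix_trace

lemma maximalTrace_mono {Λ : ℝ} (hΛ : 0 ≤ Λ) {X Y : Matrix (Fin N) (Fin N) ℝ}
    (h : (X - Y).PosSemidef) : maximalTrace Λ Y ≤ maximalTrace Λ X := by
  refine csSup_le ⟨_, mem_image_of_mem _ (zero_mem_boundedNonnegMatrices hΛ)⟩ ?_
  rintro _ ⟨A, hA, rfl⟩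
  have h1 := trace_mul_nonneg hA.2 h
  rw [Matrix.mul_sub, Matrix.trace_sub] at h1
  exact le_trans (by simpa using h1) (trace_mul_le_maximalTrace hA X)

lemma maximalTrace_smul_one_le {Λ κ : ℝ} (hΛ : 0 ≤ Λ) (hκ : 0 ≤ κ) :
    maximalTrace Λ (κ • (1 : Matrix (Fin N) (Fin N) ℝ)) ≤ N * Λ * κ := by
  refine csSup_le ⟨_, mem_image_of_mem _ (zero_mem_boundedNonnegMatrices hΛ)⟩ ?_
  rintro _ ⟨A, hA, rfl⟩
  simp only [Matrix.mul_smul, Matrix.mul_one, Matrix.trace_smul, smul_eq_mul]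
  have := mul_le_mul_of_nonneg_left (trace_le_of_mem_boundedNonnegMatrices hA) hκ
  linarith

/-- The extremal operator `-sup_A Tr(A M) + K₁ |p| ^ m - C`. -/
noncomputable def extremalOperator (Λ K₁ m C : ℝ) (M : Matrix (Fin N) (Fin N) ℝ)
    (p : Eucl N) : ℝ :=
  -maximalTrace Λ M + K₁ * ‖p‖ ^ m - C

lemma isContinuousElliptic_extremalOperator {Λ m : ℝ} (hΛ : 0 ≤ Λ) (hm : 0 ≤ m) (K₁ C : ℝ) :
    IsContinuousElliptic (extremalOperator (N := N) Λ K₁ m C) := by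
  refine ⟨Continuous.continuousOn ?_, fun p X Y _ _ h => ?_⟩
  · have h1 : Continuous fun q : Matrix (Fin N) (Fin N) ℝ × Eucl N => maximalTrace Λ q.1 :=
      (continuous_maximalTrace Λ).comp continuous_fst
    have h2 : Continuous fun q : Matrix (Fin N) (Fin N) ℝ × Eucl N => ‖q.2‖ ^ m :=
      (Real.continuous_rpow_const hm).comp continuous_snd.norm
    exact (h1.neg.add (continuous_const.mul h2)).sub continuous_const
  · have := maximalTrace_mono hΛ h
    unfold extremalOperator
    linarith

/-- Subsolutions of the extremal equation are subsolutions in the sense of paraboloids. -/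
lemma isParaboloidSubsolution_of_extremalOperator {Λ K₁ m C : ℝ} (hΛ : 0 ≤ Λ)
    {A : Set (Eucl N)} {v : Eucl N → ℝ}
    (hv : IsViscositySubsolution (fun M p _ _ => extremalOperator Λ K₁ m C M p) A v) :
    IsParaboloidSubsolution K₁ m C (N * Λ) A v := by
  intro x hx p κ hκ h
  have h1 := hv.2 _ (contDiff_paraboloid x p κ) x hx (by
    refine Filter.Eventually.filter_mono nhdsWithin_le_nhds ?_
    filter_upwards [h] with y hy
    simp only [sub_self, inner_zero_right, norm_zero]
    linarith)
  rw [gradient_paraboloid, hessian_paraboloid] at h1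
  have h2 := maximalTrace_smul_one_le (N := N) hΛ hκ
  simp only [extremalOperator] at h1
  linarith

/-- A subsolution of the Hamilton-Jacobi equation is a subsolution of the extremal equation where
the coefficients are bounded. -/
lemma isViscositySubsolution_extremalOperator {Ω : Set (Eucl N)} {U : Set (Eucl N)}
    {a : Eucl N → Matrix (Fin N) (Fin N) ℝ} {H : Eucl N → Eucl N → ℝ}
    {c f u : Eucl N → ℝ} {K₁ K₂ m Λ C : ℝ} (hU : IsOpen U) (hUΩ : U ⊆ Ω)
    (ha : ∀ x ∈ U, a x ∈ boundedNonnegMatrices N Λ)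
    (hH : ∀ x ∈ U, ∀ p : Eucl N, K₁ * ‖p‖ ^ m - K₂ ≤ H x p)
    (hC : ∀ x ∈ U, K₂ + f x - c x * u x ≤ C)
    (hu : IsViscositySubsolution (hjOperator a H c f) Ω u) :
    IsViscositySubsolution (fun M p _ _ => extremalOperator Λ K₁ m C M p) U u := by
  refine ⟨hu.1.mono hUΩ, fun φ hφ x hx hmax => ?_⟩
  have hmax' : IsLocalMaxOn (fun y => u y - φ y) Ω x := by
    rw [IsLocalMaxOn, hU.nhdsWithin_eq hx] at hmax
    exact Filter.Eventually.filter_mono nhdsWithin_le_nhds hmax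
  have h1 := hu.2 φ hφ x (hUΩ hx) hmax'
  have h2 := trace_mul_le_maximalTrace (ha x hx) (hessian φ x)
  have h3 := hH x hx (gradient φ x)
  have h4 := hC x hx
  simp only [hjOperator] at h1
  simp only [extremalOperator]
  linarith

/-- The barrier is a strict supersolution of the extremal equation, up to the boundary. -/
lemma isViscositySupersolution_barrier {α B r K₁ m Λ C : ℝ} (hα : 0 < α) (hα1 : α < 1)
    (hB : 0 < B) (hr : 0 < r) (hΛ : 0 ≤ Λ)
    (hbar : ∀ x : Eucl N, x ≠ 0 → ‖x‖ < r →
      C + 1 + N * Λ * barrierCurv α B r x ≤ K₁ * ‖barrierSlope α B r x‖ ^ m) :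
    IsViscositySupersolution (fun M p _ _ => extremalOperator Λ K₁ m C M p - 1)
      (closedBall (0 : Eucl N) r \ {0}) (fun x => barrierProfile α B r ‖x‖) := by
  refine ⟨((continuous_barrierProfile hα B r).comp
    continuous_norm).lowerSemicontinuous.lowerSemicontinuousOn _, fun φ hφ x hx hmin => ?_⟩
  have hx0 : x ≠ 0 := hx.2
  rcases (mem_closedBall_zero_iff.1 hx.1).lt_or_eq with hxr | hxr
  · have hnhds : closedBall (0 : Eucl N) r \ {0} ∈ 𝓝 x := by
      refine Filter.inter_mem ?_ (isOpen_compl_singleton.mem_nhds hx0)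
      exact mem_of_superset (isOpen_ball.mem_nhds (mem_ball_zero_iff.2 hxr)) ball_subset_closedBall
    obtain ⟨h1, h2⟩ := touching_paraboloid hφ
      (barrierProfile_le_paraboloid hα hα1.le hB.le hx0 hxr) (hmin.isLocalMin hnhds)
    have h3 := maximalTrace_mono hΛ h2
    have h4 := maximalTrace_smul_one_le (N := N) hΛ (barrierCurv_nonneg hα hB.le hxr.le)
    have h5 := hbar x hx0 hxr
    simp only [extremalOperator, h1]
    linarith
  · exact absurd hmin (not_isLocalMinOn_barrierProfile_sub hα hα1 hB hr hxr
      (hφ.differentiable (by norm_num) x))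

end Elliptic

/-! ### Balls inside an open set -/

section Balls
variable {N : ℕ} {Ω : Set (Eucl N)}

/-- The ball is connected and misses the frontier, so `Ω` is clopen in it. The extended distance
also covers an empty frontier. -/
lemma ball_subset_of_le_infEDist_frontier (hΩ : IsOpen Ω) {x : Eucl N} (hx : x ∈ Ω) {r : ℝ}
    (h : ENNReal.ofReal r ≤ infEDist x (frontier Ω)) : ball x r ⊆ Ω := by
  rcases le_or_gt r 0 with hr | hr
  · simp [ball_eq_empty.2 hr]
  have hdisj : Disjoint (frontier Ω) (ball x r) := by
    rw [Set.disjoint_left]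
    intro y hy hyb
    have h1 := h.trans (infEDist_le_edist_of_mem hy)
    rw [edist_dist, ENNReal.ofReal_le_ofReal_iff dist_nonneg, dist_comm] at h1
    exact absurd (mem_ball.1 hyb) (not_lt.2 h1)
  have hconn : IsPreconnected (ball x r) := (convex_ball x r).isPreconnected
  have := isPreconnected_iff_preconnectedSpace.1 hconn
  have hu := (isClopen_preimage_val hΩ hdisj).eq_univ ⟨⟨x, mem_ball_self hr⟩, hx⟩
  intro y hy
  have : (⟨y, hy⟩ : ball x r) ∈ (Subtype.val ⁻¹' Ω : Set (ball x r)) := by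
    rw [hu]; trivial
  exact this

/-- If the frontier is empty, `infDist` takes the default value `0` and the ball is empty. -/
lemma ball_infDist_frontier_subset (hΩ : IsOpen Ω) {x : Eucl N} (hx : x ∈ Ω) :
    ball x (infDist x (frontier Ω)) ⊆ Ω :=
  ball_subset_of_le_infEDist_frontier hΩ hx ENNReal.ofReal_toReal_le

/-- Points of the closure outside `Ω` lie on the frontier, at distance zero, so taking the closure
adds nothing to this set. -/
lemma isCompact_le_infEDist_frontier (hb : Bornology.IsBounded Ω) {r : ℝ} (hr : 0 < r) :
    IsCompact {x | x ∈ Ω ∧ ENNReal.ofReal r ≤ infEDist x (frontier Ω)} := by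
  have heq : {x | x ∈ Ω ∧ ENNReal.ofReal r ≤ infEDist x (frontier Ω)} =
      closure Ω ∩ {x | ENNReal.ofReal r ≤ infEDist x (frontier Ω)} := by
    ext x
    refine ⟨fun h => ⟨subset_closure h.1, h.2⟩, fun h => ⟨?_, h.2⟩⟩
    by_contra hx
    have hf : x ∈ frontier Ω := ⟨h.1, fun hi => hx (interior_subset hi)⟩
    have h2 : ENNReal.ofReal r ≤ infEDist x (frontier Ω) := h.2
    rw [infEDist_zero_of_mem hf] at h2
    exact absurd h2 (not_le.2 (ENNReal.ofReal_pos.2 hr))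
  rw [heq]
  exact hb.isCompact_closure.inter_right (isClosed_le continuous_const continuous_infEDist)

end Balls

/-! ### Bounds on coefficients and source terms -/

section Bounds
variable {N : ℕ}

lemma SuperquadHJ.BoundedOn.mono {u : Eucl N → ℝ} {A A' : Set (Eucl N)} (h : BoundedOn u A) (hA : A' ⊆ A) :
    BoundedOn u A' :=
  h.imp fun _ hC x hx => hC x (hA hx)

lemma IsCompact.boundedOn {u : Eucl N → ℝ} {A : Set (Eucl N)} (hA : IsCompact A)
    (hu : ContinuousOn u A) : BoundedOn u A := by
  obtain ⟨C, hC⟩ := hA.exists_bound_of_continuousOn hu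
  exact ⟨C, fun x hx => hC x hx⟩

lemma exists_entry_bound {a : Eucl N → Matrix (Fin N) (Fin N) ℝ} {A : Set (Eucl N)}
    (h : ∀ i j, BoundedOn (fun x => a x i j) A) :
    ∃ Λ : ℝ, 0 ≤ Λ ∧ ∀ x ∈ A, ∀ i j, |a x i j| ≤ Λ := by
  choose C hC using h
  refine ⟨∑ i, ∑ j, |C i j|, by positivity, fun x hx i j => (hC i j x hx).trans ?_⟩
  refine (le_abs_self _).trans ?_
  refine (Finset.single_le_sum (f := fun j => |C i j|) (fun _ _ => abs_nonneg _)
    (Finset.mem_univ j)).trans ?_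
  exact Finset.single_le_sum (f := fun i => ∑ j, |C i j|)
    (fun _ _ => Finset.sum_nonneg fun _ _ => abs_nonneg _) (Finset.mem_univ i)

lemma IsCompact.boundedOn_entry {a : Eucl N → Matrix (Fin N) (Fin N) ℝ} {A : Set (Eucl N)}
    (hA : IsCompact A) (ha : ContinuousOn a A) (i j : Fin N) : BoundedOn (fun x => a x i j) A :=
  hA.boundedOn (continuousOn_pi.1 (continuousOn_pi.1 ha i) j)

/-- Only a lower bound on `c u` enters, which permits the global result without assuming `u`
bounded. -/
lemma exists_source_bound {c f u : Eucl N → ℝ} {A : Set (Eucl N)} (K₂ : ℝ) (hf : BoundedOn f A)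
    (hcu : ∃ C : ℝ, ∀ x ∈ A, C ≤ c x * u x) :
    ∃ C : ℝ, 0 ≤ C ∧ ∀ x ∈ A, K₂ + f x - c x * u x ≤ C := by
  obtain ⟨F, hF⟩ := hf
  obtain ⟨D, hD⟩ := hcu
  refine ⟨|K₂| + |F| + |D|, by positivity, fun x hx => ?_⟩
  have h1 := (abs_le.1 (hF x hx)).2
  have h2 := hD x hx
  linarith [le_abs_self K₂, le_abs_self F, neg_abs_le D]

lemma SuperquadHJ.BoundedOn.exists_le_mul {c u : Eucl N → ℝ} {A : Set (Eucl N)} (hc : BoundedOn c A)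
    (hu : BoundedOn u A) : ∃ C : ℝ, ∀ x ∈ A, C ≤ c x * u x := by
  obtain ⟨D, hD⟩ := hc
  obtain ⟨U, hU⟩ := hu
  refine ⟨-(D * U), fun x hx => (abs_le.1 ?_).1⟩
  rw [abs_mul]
  exact mul_le_mul (hD x hx) (hU x hx) (abs_nonneg _) ((abs_nonneg _).trans (hD x hx))

end Bounds

/-! ### The Hölder exponent -/

section Exponent
variable {m : ℝ}

lemma holderExponent_pos (hm : 2 < m) : 0 < (m - 2) / (m - 1) :=
  div_pos (by linarith) (by linarith)

lemma holderExponent_lt_one (hm : 2 < m) : (m - 2) / (m - 1) < 1 := by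
  rw [div_lt_one (by linarith)]; linarith

/-- This is the scaling balance: the `m`-th power of a slope `s^(α-1)` has the homogeneity of the
curvature `s^(α-2)`. -/
lemma one_sub_holderExponent_mul (hm : 2 < m) :
    (1 - (m - 2) / (m - 1)) * m = 2 - (m - 2) / (m - 1) := by
  have : m - 1 ≠ 0 := by linarith
  field_simp; ring

end Exponent

/-! ### Verification of (H1)–(H3) -/

section Structure
variable {N : ℕ} {Ω : Set (Eucl N)}

/-- The structural assumptions hold for locally bounded subsolutions in bounded open sets. -/
theorem exists_structural_assumptions (hΩ : IsOpen Ω)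
    {a : Eucl N → Matrix (Fin N) (Fin N) ℝ} {H : Eucl N → Eucl N → ℝ} {c f : Eucl N → ℝ}
    (ha : ContinuousOn a (closure Ω))
    (ha_nonneg : ∀ x ∈ closure Ω, ∀ p : Fin N → ℝ, 0 ≤ (a x).mulVec p ⬝ᵥ p)
    {K₁ K₂ m : ℝ} (hK₁ : 0 < K₁) (hm : 2 < m)
    (hH_coercive : ∀ x ∈ closure Ω, ∀ p : Eucl N, K₁ * ‖p‖ ^ m - K₂ ≤ H x p)
    (hc : ContinuousOn c (closure Ω)) (hf : ContinuousOn f (closure Ω))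
    (hb : Bornology.IsBounded Ω) {u : Eucl N → ℝ} (hul : LocallyBoundedOn u Ω)
    (hu : IsViscositySubsolution (hjOperator a H c f) Ω u) :
    ∃ (r₀ : ℝ) (G : ℝ → Matrix (Fin N) (Fin N) ℝ → Eucl N → ℝ) (w : ℝ → ℝ → ℝ),
      0 < r₀ ∧ AssumptionH1 2 Ω u r₀ G ∧
      AssumptionH2 r₀ G (fun r x => w r ‖x‖) ∧
      AssumptionH3 r₀ G (fun r x => w r ‖x‖) ∧
      ∀ r : ℝ, 0 < r → r ≤ r₀ → ∃ K : ℝ, 0 < K ∧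
        ∀ s ∈ Icc (0 : ℝ) r, w r s ≤ K * s ^ ((m - 2) / (m - 1)) := by
  set α := (m - 2) / (m - 1)
  have hα : 0 < α := holderExponent_pos hm
  have hα1 : α < 1 := holderExponent_lt_one hm
  have hcomp : IsCompact (closure Ω) := hb.isCompact_closure
  obtain ⟨Λ, hΛ, hΛa⟩ := exists_entry_bound (hcomp.boundedOn_entry ha)
  have hΘ : (0 : ℝ) ≤ N * Λ := by positivity
  set S : ℝ → Set (Eucl N) := fun r => {x | x ∈ Ω ∧ ENNReal.ofReal r ≤ infEDist x (frontier Ω)}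
  have hS : ∀ r, S r ⊆ Ω := fun r x hx => hx.1
  have hex : ∀ r : ℝ, ∃ C : ℝ, 0 ≤ C ∧ (0 < r → ∀ x ∈ S r, K₂ + f x - c x * u x ≤ C) := by
    intro r
    by_cases hr : 0 < r
    · have hSc := (hS r).trans subset_closure
      obtain ⟨C, hC, h⟩ := exists_source_bound K₂ ((hcomp.boundedOn hf).mono hSc)
        (((hcomp.boundedOn hc).mono hSc).exists_le_mul
          (hul (S r) (hS r) (isCompact_le_infEDist_frontier hb hr)))
      exact ⟨C, hC, fun _ => h⟩
    · exact ⟨0, le_rfl, fun h => absurd h hr⟩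
  choose C hC0 hC using hex
  have hexB := fun r => exists_barrier_constant (E := Eucl N) hα hα1.le hm
    (one_sub_holderExponent_mul hm) hK₁ (hC0 r) hΘ
  choose B hB0 hB using hexB
  refine ⟨1, fun r => extremalOperator Λ K₁ m (C r), fun r => barrierProfile α (B r) r, one_pos,
    fun r hr hr1 => ⟨isContinuousElliptic_extremalOperator hΛ (by linarith) _ _, fun x hx hd => ?_⟩,
    fun r hr hr1 => ⟨?_, ?_, fun y hy => ?_, 1, one_pos, ?_⟩,
    fun r hr hr1 v hvb hvusc hv y hy => ?_, fun r hr hr1 => ?_⟩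
  -- The factor `2` in (H1) is spent here: every point of the ball keeps distance at least `r` to
  -- the frontier.
  · have hsub : ball x r ⊆ S r := by
      have h1 := ball_subset_of_le_infEDist_frontier hΩ hx hd
      refine fun y hy => ⟨h1 (ball_subset_ball (by linarith) hy), ?_⟩
      have h2 : ENNReal.ofReal (2 * r) ≤ edist x y + infEDist y (frontier Ω) :=
        hd.trans infEDist_le_edist_add_infEDist
      have h3 : edist x y ≤ ENNReal.ofReal r := by
        rw [edist_comm, edist_dist]; exact ENNReal.ofReal_le_ofReal (mem_ball.1 hy).le
      rw [two_mul, ENNReal.ofReal_add hr.le hr.le] at h2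
      exact (ENNReal.add_le_add_iff_left ENNReal.ofReal_ne_top).1
        (h2.trans (add_le_add_left h3 _))
    have hcl : ∀ y ∈ ball x r, y ∈ closure Ω := fun y hy => subset_closure (hsub hy).1
    exact isViscositySubsolution_extremalOperator isOpen_ball (hsub.trans (hS r))
      (fun y hy => ⟨hΛa y (hcl y hy), ha_nonneg y (hcl y hy)⟩)
      (fun y hy => hH_coercive y (hcl y hy)) (fun y hy => hC r hr y (hsub hy)) hu
  · exact ((continuous_barrierProfile hα (B r) r).comp continuous_norm).continuousOn
  · simp only [norm_zero, barrierProfile_zero hα]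
  · exact barrierProfile_nonneg hα (hB0 r).le (norm_nonneg y) (mem_ball_zero_iff.1 hy).le
  · exact isViscositySupersolution_barrier hα hα1 (hB0 r) hr hΛ (hB r r hr1)
  · obtain ⟨M, hM⟩ := hvb
    exact (isParaboloidSubsolution_of_extremalOperator hΛ hv).le_add_barrier_zero hm (hC0 r) hΘ
      hα hα1 (hB0 r) (hB r r hr1) (fun y hy => (abs_le.1 (hM y hy)).2) hvusc hy
  · have := hB0 r
    exact ⟨2 * B r / α, by positivity, fun s hs => barrierProfile_le hα hα1.le this.le hs.1 hs.2⟩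

end Structure

/-! ### Interior Hölder estimates and extension to the closure -/

section Holder
variable {N : ℕ}

/-- The two-point estimate inside a common ball radius, with a constant depending only on the
constants of the inequality. -/
theorem IsParaboloidSubsolution.exists_two_point_estimate {K₁ m C Θ : ℝ} {Ω : Set (Eucl N)}
    {u : Eucl N → ℝ} (hK₁ : 0 < K₁) (hm : 2 < m) (hC : 0 ≤ C) (hΘ : 0 ≤ Θ)
    (husc : UpperSemicontinuousOn u Ω) (hu : IsParaboloidSubsolution K₁ m C Θ Ω u) :
    ∃ K : ℝ, 0 ≤ K ∧ ∀ (x y : Eucl N) (r : ℝ), r ≤ 1 → ball x r ⊆ Ω → ball y r ⊆ Ω →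
      dist x y < r → |u x - u y| ≤ K * dist x y ^ ((m - 2) / (m - 1)) := by
  set α := (m - 2) / (m - 1)
  have hα : 0 < α := holderExponent_pos hm
  have hα1 : α < 1 := holderExponent_lt_one hm
  obtain ⟨B, hB0, hB⟩ := exists_barrier_constant (E := Eucl N) hα hα1.le hm
    (one_sub_holderExponent_mul hm) hK₁ hC hΘ
  have key : ∀ (x y : Eucl N) (r : ℝ), r ≤ 1 → ball x r ⊆ Ω → dist y x < r →
      u y ≤ u x + 2 * B / α * dist y x ^ α := by
    intro x y r hr hx hxy
    -- Shrinking the radius gives a compact ball, on which semicontinuity bounds `u` above. That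
    -- bound never enters `B`, so the constant is uniform.
    obtain ⟨r', hr1, hr2⟩ := exists_between hxy
    have hcb : closedBall x r' ⊆ Ω := (closedBall_subset_ball hr2).trans hx
    obtain ⟨M, hM⟩ := (husc.mono hcb).bddAbove_of_isCompact (isCompact_closedBall x r')
    have hbΩ := ball_subset_closedBall.trans hcb
    have h1 := (hu.mono hbΩ).le_add_barrier hm hC hΘ hα hα1 hB0 (hB r' (by linarith))
      (fun z hz => hM (mem_image_of_mem u (ball_subset_closedBall hz))) (husc.mono hbΩ) hr1
    have h2 := barrierProfile_le (B := B) hα hα1.le hB0.le (dist_nonneg (x := y) (y := x)) hr1.le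
    rw [← dist_eq_norm] at h1
    linarith
  refine ⟨2 * B / α, by positivity, fun x y r hr hx hy hxy => abs_le.2 ⟨?_, ?_⟩⟩
  · have := key x y r hr hx (by rwa [dist_comm])
    rw [dist_comm] at this
    linarith
  · have := key y x r hr hy hxy
    linarith

lemma holderOnWith_of_abs_sub_le {α K : ℝ} (hα : 0 ≤ α) (hK : 0 ≤ K) {u : Eucl N → ℝ}
    {A : Set (Eucl N)} (h : ∀ x ∈ A, ∀ y ∈ A, |u x - u y| ≤ K * dist x y ^ α) :
    HolderOnWith K.toNNReal α.toNNReal u A := by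
  intro x hx y hy
  have h1 := ENNReal.ofReal_le_ofReal (h x hx y hy)
  rw [ENNReal.ofReal_mul hK, ← ENNReal.ofReal_rpow_of_nonneg dist_nonneg hα, ← edist_dist] at h1
  rw [edist_dist, Real.dist_eq, Real.coe_toNNReal α hα]
  exact h1

/-- A bounded function satisfying a Hölder estimate at small distances satisfies it at all
distances. -/
lemma exists_abs_sub_le_of_local {α δ K M : ℝ} (hα : 0 ≤ α) (hδ : 0 < δ) (hK : 0 ≤ K)
    {u : Eucl N → ℝ} {A : Set (Eucl N)} (hM : ∀ x ∈ A, |u x| ≤ M)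
    (h : ∀ x ∈ A, ∀ y ∈ A, dist x y < δ → |u x - u y| ≤ K * dist x y ^ α) :
    ∃ K' : ℝ, 0 ≤ K' ∧ ∀ x ∈ A, ∀ y ∈ A, |u x - u y| ≤ K' * dist x y ^ α := by
  have hδα : 0 < δ ^ α := Real.rpow_pos_of_pos hδ α
  refine ⟨max K (2 * M / δ ^ α), hK.trans (le_max_left _ _), fun x hx y hy => ?_⟩
  have hd : 0 ≤ dist x y ^ α := Real.rpow_nonneg dist_nonneg α
  rcases lt_or_ge (dist x y) δ with hlt | hge
  · exact (h x hx y hy hlt).trans (mul_le_mul_of_nonneg_right (le_max_left _ _) hd)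
  · have hM0 : 0 ≤ M := (abs_nonneg _).trans (hM x hx)
    have h1 : |u x - u y| ≤ 2 * M := by
      have := abs_sub (u x) (u y); linarith [hM x hx, hM y hy]
    have h2 : δ ^ α ≤ dist x y ^ α := Real.rpow_le_rpow hδ.le hge hα
    calc |u x - u y| ≤ 2 * M / δ ^ α * δ ^ α := by rw [div_mul_cancel₀ _ hδα.ne']; exact h1
      _ ≤ 2 * M / δ ^ α * dist x y ^ α := mul_le_mul_of_nonneg_left h2 (by positivity)
      _ ≤ _ := mul_le_mul_of_nonneg_right (le_max_right _ _) hd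

/-- Interior regularity of locally bounded subsolutions. -/
theorem locallyHolderOn_of_subsolution {Ω : Set (Eucl N)} (hΩ : IsOpen Ω)
    {a : Eucl N → Matrix (Fin N) (Fin N) ℝ} {H : Eucl N → Eucl N → ℝ} {c f : Eucl N → ℝ}
    (ha : ContinuousOn a (closure Ω))
    (ha_nonneg : ∀ x ∈ closure Ω, ∀ p : Fin N → ℝ, 0 ≤ (a x).mulVec p ⬝ᵥ p)
    {K₁ K₂ m : ℝ} (hK₁ : 0 < K₁) (hm : 2 < m)
    (hH_coercive : ∀ x ∈ closure Ω, ∀ p : Eucl N, K₁ * ‖p‖ ^ m - K₂ ≤ H x p)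
    (hc : ContinuousOn c (closure Ω)) (hf : ContinuousOn f (closure Ω))
    {u : Eucl N → ℝ} (hul : LocallyBoundedOn u Ω)
    (hu : IsViscositySubsolution (hjOperator a H c f) Ω u) :
    LocallyHolderOn ((m - 2) / (m - 1)) u Ω := by
  intro K hKΩ hK
  obtain ⟨δ, hδ, hδΩ⟩ := hK.exists_cthickening_subset_open hΩ hKΩ
  have hcomp : IsCompact (cthickening δ K) := hK.cthickening
  have hcl := hδΩ.trans subset_closure
  obtain ⟨Λ, hΛ, hΛa⟩ := exists_entry_bound (hcomp.boundedOn_entry (ha.mono hcl))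
  obtain ⟨C, hC, hCu⟩ := exists_source_bound K₂ (hcomp.boundedOn (hf.mono hcl))
    ((hcomp.boundedOn (hc.mono hcl)).exists_le_mul (hul _ hδΩ hcomp))
  have ht : thickening δ K ⊆ cthickening δ K := thickening_subset_cthickening δ K
  have hsub : IsViscositySubsolution (fun M p _ _ => extremalOperator Λ K₁ m C M p)
      (thickening δ K) u :=
    isViscositySubsolution_extremalOperator isOpen_thickening (ht.trans hδΩ)
      (fun y hy => ⟨hΛa y (ht hy), ha_nonneg y (hcl (ht hy))⟩)
      (fun y hy => hH_coercive y (hcl (ht hy))) (fun y hy => hCu y (ht hy)) hu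
  obtain ⟨L, hL, hest⟩ := (isParaboloidSubsolution_of_extremalOperator hΛ
    hsub).exists_two_point_estimate hK₁ hm hC (by positivity) hsub.1
  obtain ⟨M, hM⟩ := hul K hKΩ hK
  have hα := (holderExponent_pos hm).le
  obtain ⟨L', hL', h⟩ := exists_abs_sub_le_of_local (δ := min δ 1) hα (by positivity) hL hM
    (fun x hx y hy hxy => hest x y (min δ 1) (min_le_right _ _)
      ((ball_subset_ball (min_le_left _ _)).trans (ball_subset_thickening hx δ))
      ((ball_subset_ball (min_le_left _ _)).trans (ball_subset_thickening hy δ)) hxy)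
  exact ⟨_, holderOnWith_of_abs_sub_le hα hL' h⟩

/-- Hölder continuous functions extend to the closure. -/
lemma holderUpToBoundary_of_abs_sub_le {α K : ℝ} (hα : 0 < α) (hα1 : α ≤ 1) (hK : 0 ≤ K)
    {u : Eucl N → ℝ} {Ω : Set (Eucl N)} (hb : BoundedOn u Ω)
    (h : ∀ x ∈ Ω, ∀ y ∈ Ω, |u x - u y| ≤ K * dist x y ^ α) : HolderUpToBoundary α u Ω := by
  rcases Ω.eq_empty_or_nonempty with rfl | hne
  · exact ⟨u, fun _ hx => hx.elim, ⟨0, by simp⟩, 0, by simp [HolderOnWith]⟩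
  obtain ⟨M, hM⟩ := hb
  have : Nonempty Ω := hne.to_subtype
  have hpos : ∀ x y : Eucl N, 0 ≤ K * dist x y ^ α := fun x y =>
    mul_nonneg hK (Real.rpow_nonneg dist_nonneg α)
  have htri : ∀ x y z : Eucl N, K * dist x z ^ α ≤ K * dist x y ^ α + K * dist y z ^ α := by
    intro x y z
    rw [← mul_add]
    refine mul_le_mul_of_nonneg_left ?_ hK
    exact (Real.rpow_le_rpow dist_nonneg (dist_triangle x y z) hα.le).trans
      (Real.rpow_add_le_add_rpow dist_nonneg dist_nonneg hα.le hα1)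
  -- McShane extension: for `α ≤ 1`, `K · dist^α` satisfies the triangle inequality `htri`.
  set v : Eucl N → ℝ := fun x => ⨅ y : Ω, (u y + K * dist x y ^ α)
  have hbdd : ∀ x : Eucl N, BddBelow (range fun y : Ω => u y + K * dist x y ^ α) := by
    intro x
    refine ⟨-M, ?_⟩
    rintro _ ⟨y, rfl⟩
    have := (abs_le.1 (hM y y.2)).1
    have := hpos x y
    simp only
    linarith
  have hv : ∀ x y, v x ≤ v y + K * dist x y ^ α := by
    intro x y
    rw [← sub_le_iff_le_add]
    refine le_ciInf fun z => ?_
    have h1 : v x ≤ u z + K * dist x z ^ α := ciInf_le (hbdd x) z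
    have := htri x y z
    linarith
  have habs : ∀ x y, |v x - v y| ≤ K * dist x y ^ α := by
    intro x y
    have h1 := hv y x
    rw [dist_comm] at h1
    exact abs_le.2 ⟨by linarith, by linarith [hv x y]⟩
  have heq : EqOn v u Ω := by
    intro x hx
    refine le_antisymm ?_ (le_ciInf fun y => ?_)
    · have := ciInf_le (hbdd x) ⟨x, hx⟩
      simpa [Real.zero_rpow hα.ne'] using this
    · have := (abs_le.1 (h x hx y y.2)).2
      linarith
  refine ⟨v, heq, ⟨M + K, fun x hx => ?_⟩, _,
    holderOnWith_of_abs_sub_le hα.le hK fun x _ y _ => habs x y⟩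
  obtain ⟨y, hy, hxy⟩ := Metric.mem_closure_iff.1 hx 1 one_pos
  have h1 := habs x y
  have h2 : K * dist x y ^ α ≤ K :=
    mul_le_of_le_one_right hK (Real.rpow_le_one dist_nonneg hxy.le hα.le)
  have h3 := hM y hy
  rw [heq hy] at h1
  have h4 := abs_sub_abs_le_abs_sub (v x) (u y)
  linarith

end Holder

/-! ### The gradient of the distance function -/

section Distance
variable {N : ℕ} {F : Set (Eucl N)}

lemma hasDerivAt_infDist_line {x e : Eucl N} {t : ℝ}
    (h : DifferentiableAt ℝ (fun y => infDist y F) (x + t • e)) :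
    HasDerivAt (fun s : ℝ => infDist (x + s • e) F)
      (inner ℝ (gradient (fun y => infDist y F) (x + t • e)) e) t := by
  have hline : HasDerivAt (fun t : ℝ => x + t • e) e t := by
    simpa using ((hasDerivAt_id t).smul_const e).const_add x
  rw [inner_gradient_left]
  exact h.hasFDerivAt.comp_hasDerivAt t hline

/-- The eikonal equation for the distance function. -/
lemma norm_gradient_infDist (hF : IsClosed F) (hne : F.Nonempty) {x : Eucl N} (hx : x ∉ F)
    (h : DifferentiableAt ℝ (fun y => infDist y F) x) :
    ‖gradient (fun y => infDist y F) x‖ = 1 := by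
  apply le_antisymm
  · rw [gradient, LinearIsometryEquiv.norm_map]
    simpa using norm_fderiv_le_of_lipschitz ℝ (x₀ := x) (lipschitz_infDist_pt F)
  · obtain ⟨z, hz, hxz⟩ := hF.exists_infDist_eq_dist hne x
    have hD : 0 < dist x z := dist_pos.2 fun hxz => hx (hxz ▸ hz)
    -- Along the unit direction to a nearest point the distance decreases at rate at least one,
    -- while it is `1`-Lipschitz.
    set e : Eucl N := (dist x z)⁻¹ • (z - x) with he
    have hzx : ‖z - x‖ = dist x z := by rw [dist_comm, dist_eq_norm]
    have hne1 : ‖e‖ = 1 := by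
      rw [he, norm_smul, Real.norm_of_nonneg (by positivity), hzx, inv_mul_cancel₀ hD.ne']
    have hd := hasDerivAt_infDist_line (F := F) (x := x) (e := e) (t := 0) (by simpa using h)
    rw [zero_smul, add_zero] at hd
    have hle : inner ℝ (gradient (fun y => infDist y F) x) e ≤ -1 := by
      have hs := (hasDerivAt_iff_tendsto_slope.1 hd).mono_left
        (nhdsWithin_mono (0 : ℝ) (fun t (ht : t ∈ Ioi (0 : ℝ)) => ne_of_gt ht))
      refine le_of_tendsto hs ?_
      filter_upwards [Ioo_mem_nhdsGT hD] with t ht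
      rw [slope_def_field, zero_smul, add_zero, sub_zero, div_le_iff₀ ht.1, hxz]
      have h1 : infDist (x + t • e) F ≤ dist (x + t • e) z := infDist_le_dist_of_mem hz
      have h2 : x + t • e - z = (dist x z - t) • (-e) := by
        have : z = x + dist x z • e := by rw [he, smul_inv_smul₀ hD.ne']; abel
        nth_rewrite 1 [this]
        module
      rw [dist_eq_norm, h2, norm_smul, norm_neg, hne1,
        Real.norm_of_nonneg (by linarith [ht.2])] at h1
      linarith
    have := abs_real_inner_le_norm (gradient (fun y => infDist y F) x) e
    rw [hne1, mul_one] at this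
    linarith [neg_le_abs (inner ℝ (gradient (fun y => infDist y F) x) e)]

end Distance

/-! ### Estimates up to the boundary -/

section Collar
variable {N : ℕ} {Ω : Set (Eucl N)}

/-- Moving along the gradient of the distance increases the distance at a uniform rate. -/
lemma infDist_add_smul_gradient_ge (hΩ : IsOpen Ω) (hne : (frontier Ω).Nonempty) {δ₀ T : ℝ}
    {L : ℝ≥0} (hd : ∀ x ∈ Ω, infDist x (frontier Ω) < δ₀ →
      DifferentiableAt ℝ (fun y => infDist y (frontier Ω)) x)
    (hL : LipschitzOnWith L (gradient fun y => infDist y (frontier Ω))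
      {x | x ∈ Ω ∧ infDist x (frontier Ω) < δ₀})
    (hT : T ≤ δ₀ / 2) (hLT : L * T ≤ 1 / 2) {x : Eucl N} (hx : x ∈ Ω)
    (hxδ : infDist x (frontier Ω) < δ₀ / 2) {t : ℝ} (ht0 : 0 ≤ t) (htT : t ≤ T) :
    x + t • gradient (fun y => infDist y (frontier Ω)) x ∈ Ω ∧
      infDist x (frontier Ω) + t / 2 ≤
        infDist (x + t • gradient (fun y => infDist y (frontier Ω)) x) (frontier Ω) := by
  set F := frontier Ω with hFdef
  set ν := gradient (fun y => infDist y F) x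
  have hF : IsClosed F := isClosed_frontier
  have hdisj : ∀ y ∈ Ω, y ∉ F := fun y hy hyF => by
    rw [hFdef, hΩ.frontier_eq] at hyF; exact hyF.2 hy
  have hxpos : 0 < infDist x F := (hF.notMem_iff_infDist_pos hne).1 (hdisj x hx)
  have hν : ‖ν‖ = 1 := norm_gradient_infDist hF hne (hdisj x hx) (hd x hx (by linarith))
  have hdist : ∀ s : ℝ, 0 ≤ s → dist (x + s • ν) x = s := by
    intro s hs
    rw [dist_eq_norm, add_sub_cancel_left, norm_smul, hν, mul_one, Real.norm_of_nonneg hs]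
  -- As long as the segment stays in `Ω`, the derivative of the distance along it is at least `1 - L
  -- s ≥ 1/2`.
  have key : ∀ t, 0 ≤ t → t ≤ T → (∀ s, 0 ≤ s → s < t → x + s • ν ∈ Ω) →
      infDist x F + t / 2 ≤ infDist (x + t • ν) F := by
    intro t ht0 htT hs
    have hder : ∀ s ∈ Ioo 0 t, HasDerivAt (fun s => infDist (x + s • ν) F - s / 2)
        (inner ℝ (gradient (fun y => infDist y F) (x + s • ν)) ν - 1 / 2) s ∧
        0 ≤ inner ℝ (gradient (fun y => infDist y F) (x + s • ν)) ν - 1 / 2 := by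
      intro s hst
      have hsΩ := hs s hst.1.le hst.2
      have hsd : infDist (x + s • ν) F < δ₀ := by
        have := infDist_le_infDist_add_dist (x := x + s • ν) (y := x) (s := F)
        rw [hdist s hst.1.le] at this
        linarith [hst.2]
      refine ⟨(hasDerivAt_infDist_line (hd _ hsΩ hsd)).sub ((hasDerivAt_id s).div_const 2), ?_⟩
      have h1 := hL.dist_le_mul _ ⟨hsΩ, hsd⟩ _ ⟨hx, by linarith⟩
      rw [hdist s hst.1.le, dist_eq_norm] at h1
      have h2 := abs_real_inner_le_norm (gradient (fun y => infDist y F) (x + s • ν) - ν) ν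
      rw [hν, mul_one, inner_sub_left, real_inner_self_eq_norm_sq, hν] at h2
      have h3 : (L : ℝ) * s ≤ L * T := mul_le_mul_of_nonneg_left (by linarith [hst.2]) L.2
      have h4 := neg_le_of_abs_le (h2.trans (h1.trans (h3.trans hLT)))
      linarith
    have hmono : MonotoneOn (fun s => infDist (x + s • ν) F - s / 2) (Icc 0 t) := by
      refine monotoneOn_of_deriv_nonneg (convex_Icc 0 t) ?_ ?_ ?_
      · have : Continuous fun s : ℝ => infDist (x + s • ν) F :=
          (continuous_infDist_pt F).comp (by fun_prop)
        exact (this.sub (by fun_prop)).continuousOn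
      · rw [interior_Icc]
        exact fun s hs => (hder s hs).1.differentiableAt.differentiableWithinAt
      · rw [interior_Icc]
        exact fun s hs => by rw [(hder s hs).1.deriv]; exact (hder s hs).2
    have := hmono (left_mem_Icc.2 ht0) (right_mem_Icc.2 ht0) ht0
    simp only [zero_smul, add_zero, zero_div, sub_zero] at this
    linarith
  -- A first exit point would lie on the frontier, where the distance vanishes; `key` makes it
  -- positive there.
  have hin : ∀ t, 0 ≤ t → t ≤ T → x + t • ν ∈ Ω := by
    by_contra! hcon
    obtain ⟨t₁, ht₁, ht₁T, ht₁Ω⟩ := hcon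
    have hcont : Continuous fun s : ℝ => x + s • ν := by fun_prop
    set S : Set ℝ := Icc 0 T ∩ (fun s : ℝ => x + s • ν) ⁻¹' Ωᶜ
    have hSc : IsClosed S := isClosed_Icc.inter (hΩ.isClosed_compl.preimage hcont)
    have hSb : BddBelow S := ⟨0, fun s hs => hs.1.1⟩
    have hmem : sInf S ∈ S := hSc.csInf_mem ⟨t₁, ⟨ht₁, ht₁T⟩, ht₁Ω⟩ hSb
    set τ := sInf S
    have hbefore : ∀ s, 0 ≤ s → s < τ → x + s • ν ∈ Ω := by
      intro s hs0 hsτ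
      by_contra hsΩ
      exact absurd (csInf_le hSb ⟨⟨hs0, hsτ.le.trans hmem.1.2⟩, hsΩ⟩) (not_le.2 hsτ)
    have hτ0 : 0 < τ := by
      refine lt_of_le_of_ne hmem.1.1 fun h0 => hmem.2 ?_
      simpa [← h0] using hx
    have hτcl : x + τ • ν ∈ closure Ω := by
      have h1 : Tendsto (fun s : ℝ => x + s • ν) (𝓝[<] τ) (𝓝 (x + τ • ν)) :=
        (hcont.tendsto τ).mono_left nhdsWithin_le_nhds
      refine mem_closure_of_tendsto h1 ?_
      filter_upwards [Ioo_mem_nhdsLT hτ0] with s hs using hbefore s hs.1.le hs.2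
    have hτF : x + τ • ν ∈ F := by
      rw [hFdef, hΩ.frontier_eq]
      exact ⟨hτcl, hmem.2⟩
    have h1 := key τ hτ0.le hmem.1.2 hbefore
    rw [infDist_zero_of_mem hτF] at h1
    linarith
  exact ⟨hin t ht0 htT, key t ht0 htT fun s hs0 hst => hin s hs0 (hst.le.trans htT)⟩

/-- In a `C^{1,1}` domain, a Hölder estimate between points lying well inside extends to all pairs
of close points. -/
theorem exists_local_holder_of_isC11Domain (hC : IsC11Domain Ω) {α K : ℝ} (hα : 0 < α)
    (hα1 : α ≤ 1) (hK : 0 ≤ K) {u : Eucl N → ℝ}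
    (hest : ∀ (x y : Eucl N) (r : ℝ), r ≤ 1 → ball x r ⊆ Ω → ball y r ⊆ Ω → dist x y < r →
      |u x - u y| ≤ K * dist x y ^ α) :
    ∃ δ K' : ℝ, 0 < δ ∧ 0 ≤ K' ∧
      ∀ x ∈ Ω, ∀ y ∈ Ω, dist x y < δ → |u x - u y| ≤ K' * dist x y ^ α := by
  obtain ⟨hΩ, δ₀, hδ₀, hd, L, hL⟩ := hC
  rcases (frontier Ω).eq_empty_or_nonempty with hemp | hne
  · refine ⟨1, K, one_pos, hK, fun x hx y hy hxy => hest x y 1 le_rfl ?_ ?_ hxy⟩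
    · exact ball_subset_of_le_infEDist_frontier hΩ hx (by simp [hemp])
    · exact ball_subset_of_le_infEDist_frontier hΩ hy (by simp [hemp])
  set F := frontier Ω with hFdef
  set d : Eucl N → ℝ := fun y => infDist y F with hddef
  have hF : IsClosed F := isClosed_frontier
  have hdpos : ∀ x ∈ Ω, 0 < d x := by
    intro x hx
    refine (hF.notMem_iff_infDist_pos hne).1 fun hxF => ?_
    rw [hFdef, hΩ.frontier_eq] at hxF
    exact hxF.2 hx
  have hest' : ∀ x ∈ Ω, ∀ y ∈ Ω, ∀ r ≤ 1, r ≤ d x → r ≤ d y → dist x y < r →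
      |u x - u y| ≤ K * dist x y ^ α := fun x hx y hy r hr hrx hry =>
    hest x y r hr ((ball_subset_ball hrx).trans (ball_infDist_frontier_subset hΩ hx))
      ((ball_subset_ball hry).trans (ball_infDist_frontier_subset hΩ hy))
  set T := min (δ₀ / 2) (1 / (2 * ((L : ℝ) + 1))) with hTdef
  have hL0 : (0 : ℝ) ≤ L := L.2
  have hT0 : 0 < T := lt_min (by linarith) (by positivity)
  have hT1 : T ≤ 1 / (2 * ((L : ℝ) + 1)) := min_le_right _ _
  rw [le_div_iff₀ (by positivity)] at hT1
  have hLT : (L : ℝ) * T ≤ 1 / 2 := by nlinarith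
  have hThalf : T ≤ 1 / 2 := by nlinarith
  have hTδ : T ≤ δ₀ / 2 := min_le_left _ _
  set ν := gradient d with hνdef
  have hνd : ∀ x ∈ Ω, d x < δ₀ / 2 → ‖ν x‖ = 1 := by
    intro x hx hxd
    refine norm_gradient_infDist hF hne (fun hxF => ?_) (hd x hx (by linarith))
    exact (hdpos x hx).ne' (infDist_zero_of_mem hxF)
  have hmove : ∀ x ∈ Ω, d x < δ₀ / 2 → ∀ t, 0 ≤ t → t ≤ T →
      x + t • ν x ∈ Ω ∧ d x + t / 2 ≤ d (x + t • ν x) := fun x hx hxd t ht0 htT =>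
    infDist_add_smul_gradient_ge hΩ hne hd hL hTδ hLT hx hxd ht0 htT
  -- oscillation along the normal direction
  set q : ℝ := (3 / 4) ^ α with hq
  have hq1 : q < 1 := Real.rpow_lt_one (by norm_num) (by norm_num) hα
  have hq0 : 0 < q := Real.rpow_pos_of_pos (by norm_num) α
  -- The sum of the geometric series with ratio `q`, characterised by `K + K₁ q = K₁`.
  set K₁ := K / (1 - q) with hK₁
  have hK₁0 : 0 ≤ K₁ := div_nonneg hK (by linarith)
  have hK₁eq : K + K₁ * q = K₁ := by
    have : 1 - q ≠ 0 := by linarith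
    rw [hK₁]; field_simp; ring
  have hKK₁ : K ≤ K₁ := by nlinarith
  have hnormal : ∀ x ∈ Ω, d x < δ₀ / 2 → ∀ t, 0 < t → t ≤ T →
      |u (x + t • ν x) - u x| ≤ K₁ * t ^ α := by
    intro x hx hxd
    -- Replacing `t` by `3t/4` moves the point by `t/4`, while both points are at distance at least
    -- `3t/8` from the frontier. After enough steps the length is below `d x` and the interior
    -- estimate reaches `x` directly.
    have hind : ∀ n : ℕ, ∀ t, 0 < t → t ≤ T → (3 / 4 : ℝ) ^ n * t < d x →
        |u (x + t • ν x) - u x| ≤ K₁ * t ^ α := by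
      intro n
      induction n with
      | zero =>
        intro t ht0 htT hlt
        obtain ⟨h1, h2⟩ := hmove x hx hxd t ht0.le htT
        have hdist : dist (x + t • ν x) x = t := by
          rw [dist_eq_norm, add_sub_cancel_left, norm_smul, hνd x hx hxd, mul_one,
            Real.norm_of_nonneg ht0.le]
        have h3 := hest' _ h1 x hx (min (d x) 1) (min_le_right _ _)
          ((min_le_left _ _).trans (by linarith)) (min_le_left _ _)
          (by rw [hdist]; exact lt_min (by simpa using hlt) (by linarith))
        rw [hdist] at h3
        exact h3.trans (mul_le_mul_of_nonneg_right hKK₁ (Real.rpow_nonneg ht0.le _))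
      | succ n ih =>
        intro t ht0 htT hlt
        have hs0 : 0 < 3 / 4 * t := by linarith
        have hsT : 3 / 4 * t ≤ T := by linarith
        have h0 := ih (3 / 4 * t) hs0 hsT (by rw [← mul_assoc, ← pow_succ]; exact hlt)
        obtain ⟨h1, h2⟩ := hmove x hx hxd t ht0.le htT
        obtain ⟨h3, h4⟩ := hmove x hx hxd (3 / 4 * t) hs0.le hsT
        have hdx := hdpos x hx
        have hdist : dist (x + t • ν x) (x + (3 / 4 * t) • ν x) = t / 4 := by
          rw [dist_eq_norm, show x + t • ν x - (x + (3 / 4 * t) • ν x) = (t / 4) • ν x by module,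
            norm_smul, hνd x hx hxd, mul_one, Real.norm_of_nonneg (by linarith)]
        have h5 := hest' _ h1 _ h3 (3 / 8 * t) (by linarith) (by linarith) (by linarith)
          (by rw [hdist]; linarith)
        rw [hdist] at h5
        have h6 : (t / 4) ^ α ≤ t ^ α := Real.rpow_le_rpow (by linarith) (by linarith) hα.le
        have h7 : (3 / 4 * t) ^ α = q * t ^ α := Real.mul_rpow (by norm_num) ht0.le
        rw [h7] at h0
        calc |u (x + t • ν x) - u x|
            ≤ |u (x + t • ν x) - u (x + (3 / 4 * t) • ν x)| +
              |u (x + (3 / 4 * t) • ν x) - u x| := abs_sub_le _ _ _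
          _ ≤ K * t ^ α + K₁ * (q * t ^ α) :=
              add_le_add (h5.trans (mul_le_mul_of_nonneg_left h6 hK)) h0
          _ = (K + K₁ * q) * t ^ α := by ring
          _ = K₁ * t ^ α := by rw [hK₁eq]
    intro t ht0 htT
    have hlim : Tendsto (fun n : ℕ => (3 / 4 : ℝ) ^ n * t) atTop (𝓝 (0 * t)) :=
      (tendsto_pow_atTop_nhds_zero_of_lt_one (by norm_num) (by norm_num)).mul_const t
    rw [zero_mul] at hlim
    obtain ⟨n, hn⟩ := (hlim.eventually_lt_const (hdpos x hx)).exists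
    exact hind n t ht0 htT hn
  -- The first bound puts points with `d ≤ 2ρ` in the half collar, where `ρ = dist x y`; the second
  -- allows an inward push by `8ρ`. The new constant adds the inner leg, `2K`, and two normal legs,
  -- `8K₁` each.
  refine ⟨min (δ₀ / 4) (T / 8), 2 * K * 1 + 2 * (K₁ * 8), by positivity, by positivity,
    fun x hx y hy hxy => ?_⟩
  have hρ1 : dist x y < δ₀ / 4 := hxy.trans_le (min_le_left _ _)
  have hρ2 : dist x y < T / 8 := hxy.trans_le (min_le_right _ _)
  have hρα : 0 ≤ dist x y ^ α := Real.rpow_nonneg dist_nonneg α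
  by_cases hin : dist x y < d x ∧ dist x y < d y
  · have h1 := hest' x hx y hy (min (min (d x) (d y)) 1) (min_le_right _ _)
      ((min_le_left _ _).trans (min_le_left _ _)) ((min_le_left _ _).trans (min_le_right _ _))
      (lt_min (lt_min hin.1 hin.2) (by linarith))
    refine h1.trans (mul_le_mul_of_nonneg_right ?_ hρα)
    linarith
  set ρ := dist x y with hρ
  have hdxy : d x ≤ d y + ρ := infDist_le_infDist_add_dist
  have hdyx : d y ≤ d x + ρ := by rw [hρ, dist_comm]; exact infDist_le_infDist_add_dist
  have hρ0 : 0 < ρ := by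
    by_contra hle
    exact hin ⟨(not_lt.1 hle).trans_lt (hdpos x hx), (not_lt.1 hle).trans_lt (hdpos y hy)⟩
  have hboth : d x ≤ 2 * ρ ∧ d y ≤ 2 * ρ := by
    by_contra hcon
    refine hin ⟨?_, ?_⟩ <;>
    · by_contra hle
      exact hcon ⟨by linarith, by linarith⟩
  have hxd : d x < δ₀ / 2 := by linarith [hboth.1]
  have hyd : d y < δ₀ / 2 := by linarith [hboth.2]
  obtain ⟨hx1, hx2⟩ := hmove x hx hxd (8 * ρ) (by linarith) (by linarith)
  obtain ⟨hy1, hy2⟩ := hmove y hy hyd (8 * ρ) (by linarith) (by linarith)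
  have hνL : ‖ν x - ν y‖ ≤ L * ρ := by
    rw [← dist_eq_norm]
    exact hL.dist_le_mul x ⟨hx, show d x < δ₀ by linarith⟩ y ⟨hy, show d y < δ₀ by linarith⟩
  -- The pushed points are at distance at least `4ρ` from the frontier, but the Lipschitz gradient
  -- keeps them within `2ρ` of each other, so the interior estimate applies.
  have hdist : dist (x + (8 * ρ) • ν x) (y + (8 * ρ) • ν y) ≤ 2 * ρ := by
    rw [dist_eq_norm, show x + (8 * ρ) • ν x - (y + (8 * ρ) • ν y) =
      (x - y) + (8 * ρ) • (ν x - ν y) by module]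
    refine (norm_add_le _ _).trans ?_
    rw [← dist_eq_norm, norm_smul, Real.norm_of_nonneg (by linarith : 0 ≤ 8 * ρ)]
    have h1 : 8 * ρ * ‖ν x - ν y‖ ≤ T * (L * ρ) :=
      mul_le_mul (by linarith) hνL (norm_nonneg _) hT0.le
    nlinarith
  have hdx := hdpos x hx
  have hdy := hdpos y hy
  have h1 := hest' _ hx1 _ hy1 (4 * ρ) (by linarith) (by linarith) (by linarith) (by linarith)
  have h2 := hnormal x hx hxd (8 * ρ) (by linarith) (by linarith)
  have h3 := hnormal y hy hyd (8 * ρ) (by linarith) (by linarith)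
  have hpow : ∀ k : ℝ, 1 ≤ k → (k * ρ) ^ α ≤ k * ρ ^ α := by
    intro k hk
    rw [Real.mul_rpow (by linarith) hρ0.le]
    refine mul_le_mul_of_nonneg_right ?_ hρα
    simpa using Real.rpow_le_rpow_of_exponent_le hk hα1
  have h4 : dist (x + (8 * ρ) • ν x) (y + (8 * ρ) • ν y) ^ α ≤ 2 * ρ ^ α :=
    (Real.rpow_le_rpow dist_nonneg hdist hα.le).trans (hpow 2 (by norm_num))
  have h5 := mul_le_mul_of_nonneg_left h4 hK
  have h6 := mul_le_mul_of_nonneg_left (hpow 8 (by norm_num)) hK₁0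
  have h2' := abs_le.1 h2
  have h3' := abs_le.1 h3
  have h1' := abs_le.1 h1
  exact abs_le.2 ⟨by linarith, by linarith⟩

/-- In a bounded set, a uniform estimate at small distances gives boundedness. -/
lemma boundedOn_of_local_estimate (hb : Bornology.IsBounded Ω) {α δ K : ℝ} (hα : 0 ≤ α)
    (hδ : 0 < δ) (hK : 0 ≤ K) {u : Eucl N → ℝ}
    (h : ∀ x ∈ Ω, ∀ y ∈ Ω, dist x y < δ → |u x - u y| ≤ K * dist x y ^ α) : BoundedOn u Ω := by
  have htb : TotallyBounded Ω := hb.isCompact_closure.totallyBounded.subset subset_closure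
  obtain ⟨t, htΩ, htf, hcov⟩ := Metric.finite_approx_of_totallyBounded htb δ hδ
  obtain ⟨M, hM⟩ := (htf.image fun y => |u y|).bddAbove
  refine ⟨M + K * δ ^ α, fun x hx => ?_⟩
  obtain ⟨y, hy, hxy⟩ := mem_iUnion₂.1 (hcov hx)
  have h1 := h x hx y (htΩ hy) (mem_ball.1 hxy)
  have h2 : |u y| ≤ M := hM (mem_image_of_mem _ hy)
  have h3 := mul_le_mul_of_nonneg_left
    (Real.rpow_le_rpow dist_nonneg (mem_ball.1 hxy).le hα) hK
  have h4 := abs_sub_abs_le_abs_sub (u x) (u y)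
  linarith

/-- The local estimate up to the boundary, with a uniform constant, for subsolutions in
`C^{1,1}` domains. -/
theorem exists_local_holder_of_subsolution (hC11 : IsC11Domain Ω)
    {a : Eucl N → Matrix (Fin N) (Fin N) ℝ} {H : Eucl N → Eucl N → ℝ} {c f : Eucl N → ℝ}
    (ha : ∀ i j, BoundedOn (fun x => a x i j) Ω)
    (ha_nonneg : ∀ x ∈ Ω, ∀ p : Fin N → ℝ, 0 ≤ (a x).mulVec p ⬝ᵥ p)
    {K₁ K₂ m : ℝ} (hK₁ : 0 < K₁) (hm : 2 < m)
    (hH_coercive : ∀ x ∈ Ω, ∀ p : Eucl N, K₁ * ‖p‖ ^ m - K₂ ≤ H x p)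
    (hf : BoundedOn f Ω) {u : Eucl N → ℝ}
    (hu : IsViscositySubsolution (hjOperator a H c f) Ω u)
    (hcu : ∃ C : ℝ, ∀ x ∈ Ω, C ≤ c x * u x) :
    ∃ δ K : ℝ, 0 < δ ∧ 0 ≤ K ∧ ∀ x ∈ Ω, ∀ y ∈ Ω, dist x y < δ →
      |u x - u y| ≤ K * dist x y ^ ((m - 2) / (m - 1)) := by
  obtain ⟨Λ, hΛ, hΛa⟩ := exists_entry_bound ha
  obtain ⟨C, hC, hCu⟩ := exists_source_bound K₂ hf hcu
  have hsub : IsViscositySubsolution (fun M p _ _ => extremalOperator Λ K₁ m C M p) Ω u :=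
    isViscositySubsolution_extremalOperator hC11.1 subset_rfl
      (fun y hy => ⟨hΛa y hy, ha_nonneg y hy⟩) hH_coercive hCu hu
  obtain ⟨K, hK, hest⟩ := (isParaboloidSubsolution_of_extremalOperator hΛ
    hsub).exists_two_point_estimate hK₁ hm hC (by positivity) hsub.1
  exact exists_local_holder_of_isC11Domain hC11 (holderExponent_pos hm)
    (holderExponent_lt_one hm).le hK hest

end Collar

/-! ### Assembly -/

theorem mainTheorem1 (N : ℕ) (Ω : Set (Eucl N)) (hΩ : IsOpen Ω)
    (a : Eucl N → Matrix (Fin N) (Fin N) ℝ) (H : Eucl N → Eucl N → ℝ) (c f : Eucl N → ℝ)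
    (ha : ContinuousOn a (closure Ω))
    (ha_nonneg : ∀ x ∈ closure Ω, ∀ p : Fin N → ℝ, 0 ≤ (a x).mulVec p ⬝ᵥ p)
    (hH : ContinuousOn (fun q : Eucl N × Eucl N => H q.1 q.2) (closure Ω ×ˢ univ))
    (K₁ K₂ m : ℝ) (hK₁ : 0 < K₁) (hm : 2 < m)
    (hH_coercive : ∀ x ∈ closure Ω, ∀ p : Eucl N, K₁ * ‖p‖ ^ m - K₂ ≤ H x p)
    (hc : ContinuousOn c (closure Ω)) (hf : ContinuousOn f (closure Ω)) :
    -- verification of the structural assumptions, with radial `w_r` and `w_r(s) ≤ K_r s^α`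
    (Bornology.IsBounded Ω → ∀ u : Eucl N → ℝ, LocallyBoundedOn u Ω →
      IsViscositySubsolution (hjOperator a H c f) Ω u →
      ∃ (r₀ : ℝ) (G : ℝ → Matrix (Fin N) (Fin N) ℝ → Eucl N → ℝ) (w : ℝ → ℝ → ℝ),
        0 < r₀ ∧ AssumptionH1 2 Ω u r₀ G ∧
        AssumptionH2 r₀ G (fun r x => w r ‖x‖) ∧
        AssumptionH3 r₀ G (fun r x => w r ‖x‖) ∧
        ∀ r : ℝ, 0 < r → r ≤ r₀ → ∃ K : ℝ, 0 < K ∧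
          ∀ s ∈ Icc (0 : ℝ) r, w r s ≤ K * s ^ ((m - 2) / (m - 1))) ∧
    -- interior regularity, in an arbitrary open set
    (∀ u : Eucl N → ℝ, LocallyBoundedOn u Ω →
      IsViscositySubsolution (hjOperator a H c f) Ω u →
      LocallyHolderOn ((m - 2) / (m - 1)) u Ω) ∧
    -- regularity up to the boundary for bounded subsolutions
    -- (the bounds on the coefficients are automatic when `Ω` is bounded)
    (IsC11Domain Ω → (∀ i j, BoundedOn (fun x => a x i j) Ω) → BoundedOn c Ω → BoundedOn f Ω →
      ∀ u : Eucl N → ℝ, BoundedOn u Ω →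
      IsViscositySubsolution (hjOperator a H c f) Ω u →
      HolderUpToBoundary ((m - 2) / (m - 1)) u Ω) ∧
    -- global boundedness and regularity when `c u` is bounded from below
    (IsC11Domain Ω → Bornology.IsBounded Ω → ∀ u : Eucl N → ℝ, LocallyBoundedOn u Ω →
      IsViscositySubsolution (hjOperator a H c f) Ω u →
      (∃ C : ℝ, ∀ x ∈ Ω, C ≤ c x * u x) →
      BoundedOn u Ω ∧ HolderUpToBoundary ((m - 2) / (m - 1)) u Ω) := by 
  refine ⟨fun hb u hul hu => exists_structural_assumptions hΩ ha ha_nonneg hK₁ hm hH_coercive hc hf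
      hb hul hu,
    fun u hul hu => locallyHolderOn_of_subsolution hΩ ha ha_nonneg hK₁ hm hH_coercive hc hf hul hu,
    fun hC11 hab hcb hfb u hub hu => ?_, fun hC11 hb u hul hu hcu => ?_⟩
  · obtain ⟨δ, K, hδ, hK, hest⟩ := exists_local_holder_of_subsolution hC11 hab
      (fun x hx => ha_nonneg x (subset_closure hx)) hK₁ hm
      (fun x hx => hH_coercive x (subset_closure hx)) hfb hu (hcb.exists_le_mul hub)
    obtain ⟨M, hM⟩ := hub
    obtain ⟨K', hK', h⟩ := exists_abs_sub_le_of_local (holderExponent_pos hm).le hδ hK hM hest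
    exact holderUpToBoundary_of_abs_sub_le (holderExponent_pos hm) (holderExponent_lt_one hm).le
      hK' ⟨M, hM⟩ h
  · have hcomp : IsCompact (closure Ω) := hb.isCompact_closure
    obtain ⟨δ, K, hδ, hK, hest⟩ := exists_local_holder_of_subsolution hC11
      (fun i j => BoundedOn.mono (hcomp.boundedOn_entry ha i j) subset_closure)
      (fun x hx => ha_nonneg x (subset_closure hx)) hK₁ hm
      (fun x hx => hH_coercive x (subset_closure hx))
      (BoundedOn.mono (hcomp.boundedOn hf) subset_closure) hu hcu
    -- Boundedness of `u` comes out of the estimate, whose constant used only the lower bound on `c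
    -- u`.
    have hub := boundedOn_of_local_estimate hb (holderExponent_pos hm).le hδ hK hest
    obtain ⟨M, hM⟩ := hub
    obtain ⟨K', hK', h⟩ := exists_abs_sub_le_of_local (holderExponent_pos hm).le hδ hK hM hest
    exact ⟨⟨M, hM⟩, holderUpToBoundary_of_abs_sub_le (holderExponent_pos hm)
      (holderExponent_lt_one hm).le hK' ⟨M, hM⟩ h⟩
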